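/- **Setting.** Let $d=2^n$ and let $U(d)$ be the group of $n$-qubit unitaries. For density matrices put $d_{\mathrm{tr}}(\rho,\sigma)=\frac12\|\rho-\sigma\|_1$, and $d_{\mathrm{tr}}(|\psi\rangle,|\phi\rangle)=d_{\mathrm{tr}}(|\psi\rangle\langle\psi|,|\phi\rangle\langle\phi|)$ for pure states. For $U,V\in U(d)$ put $d_{\mathrm{avg}}(U,V)=\sqrt{\mathbb{E}_{|\psi\rangle}[d_{\mathrm{tr}}(U|\psi\rangle,V|\psi\rangle)^2]}$, where $|\psi\rangle$ is a Haar-random pure state in $\mathbb{C}^d$. For an integer $r\ge 1$, an *entangled input of rank $r$* is a unit vector $|x\rangle\in\mathbb{C}^d\otimes\mathbb{C}^d$ of Schmidt rank at most $r$. A *mixed input of rank $r$* is a density matrix on $\mathbb{C}^d\otimes\mathbb{C}^d$ of the form $\rho=\sum_{j=1}^r p_j|\phi_j\rangle\langle\phi_j|\otimes|\psi_j\rangle\langle\psi_j|$ with $p_j\ge0$, $\sum_jp_j=1$ and unit vectors $|\phi_j\rangle,|\psi_j\rangle\in\mathbb{C}^d$. The unknown unitary acts on the first factor, by $U\otimes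 I$. **Theorem.** 1. (Upper bounds.) Let $n\ge 0$, $r\ge1$ and $N=\lceil 2^n/r\rceil$. - (Entangled inputs.) There are entangled inputs $|x_1\rangle,\dots,|x_N\rangle$ of rank $r$ and a function $H$ from $N$-tuples of vectors to $U(d)$ such that, for every $U\in U(d)$, $H$ applied to the vectors $((U\otimes I)|x_i\rangle)_{i=1}^N$ returns exactly $U$. Moreover, for every $U$ and all phases $z_1,\dots,z_N$ with $|z_i|=1$, $H$ applied to $(z_i(U\otimes I)|x_i\rangle)_{i=1}^N$ returns $U$ up to a global phase, so that $d_{\mathrm{avg}}(\hat U,U)=0$ for its output $\hat U$. - (Mixed inputs.) There are mixed inputs $\rho_1,\dots,\rho_N$ of rank $r$ and a function $H$ such that, for every $U\in U(d)$, $H$ applied to $((U\otimes I)\rho_i(U\otimes I)^\dagger)_{i=1}^N$ returns $U$ up to a global phase, so that $d_{\mathrm{avg}}(\hat U,U)=0$ for its output $\hat U$. 2. (Lower bounds.) For every $\epsilon_0<1$ there is an $n_0$, with $n_0\le 1$ if $\epsilon_0\le 1/3$, such that for every $\kappa>0$ there is a $c>0$ with the following property. Let $n\ge n_0$, $r\ge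 1$, $N\ge 0$, $0<\epsilon\le\epsilon_0$ and $\eta\ge\kappa\epsilon$. Consider any (possibly randomized and adaptive) learning algorithm that chooses $N$ entangled inputs $|x_i\rangle$ of rank $r$ and receives for each of them a classical description of a pure state $|y_i\rangle$. Suppose that for every $U\in U(d)$ and every noisy source of data for $U$, that is, every map $|x\rangle\mapsto|y\rangle$ with $d_{\mathrm{tr}}(|y\rangle,(U\otimes I)|x\rangle)\le\eta$ for all inputs $|x\rangle$, it outputs with probability at least $2/3$ a $\hat U\in U(d)$ with $d_{\mathrm{avg}}(\hat U,U)\le\epsilon$. Then $N\ge c\,2^n/r$. The same holds for learning algorithms that choose $N$ mixed inputs $\rho_i$ of rank $r$ and receive density matrices $\sigma_i$, with noisy sources of data $\rho\mapsto\sigma$ satisfying $d_{\mathrm{tr}}(\sigma,(U\otimes I)\rho(U\otimes I)^\dagger)\le\eta$ for all mixed inputs $\rho$. -/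

import Mathlib

open scoped Kronecker ComplexOrder

noncomputable section

namespace UnitaryLearning

/-- The index set of the computational basis of `n` qubits. -/
abbrev Qubits (n : ℕ) : Type := Fin (2 ^ n)

/-- State vectors (not necessarily normalized) with basis indexed by `ι`. -/
abbrev Vec (ι : Type) : Type := EuclideanSpace ℂ ι

/-- The projector `|x⟩⟨x|`. -/
def ketbra {ι : Type} (x : Vec ι) : Matrix ι ι ℂ :=
  Matrix.vecMulVec x.ofLp (star x.ofLp)

/-- The trace norm: the sum of the singular values, i.e. of the square roots of the
eigenvalues of `Aᴴ A`. -/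
def traceNorm {ι : Type} [Fintype ι] [DecidableEq ι] (A : Matrix ι ι ℂ) : ℝ :=
  ∑ i, Real.sqrt ((Matrix.isHermitian_conjTranspose_mul_self A).eigenvalues i)

/-- The trace distance of two density matrices. -/
def traceDist {ι : Type} [Fintype ι] [DecidableEq ι] (ρ σ : Matrix ι ι ℂ) : ℝ :=
  traceNorm (ρ - σ) / 2

/-- The trace distance of two pure states given by kets. -/
def ketDist {ι : Type} [Fintype ι] [DecidableEq ι] (x y : Vec ι) : ℝ :=
  traceDist (ketbra x) (ketbra y)

/-- The `n`-qubit unitaries. -/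
abbrev Unitaries (n : ℕ) : Type := Matrix.unitaryGroup (Qubits n) ℂ

/-- The root mean squared trace distance over Haar-random pure `n`-qubit input states.  The
Haar-random state is distributed according to the normalized surface measure on the unit sphere
of `ℂ^(2^n)` (`⨍` divides by the total mass). -/
def davg {n : ℕ} (U V : Unitaries n) : ℝ :=
  Real.sqrt (⨍ ψ : Metric.sphere (0 : Vec (Qubits n)) 1,
    ketDist (Matrix.toEuclideanLin (U : Matrix (Qubits n) (Qubits n) ℂ) ψ)
      (Matrix.toEuclideanLin (V : Matrix (Qubits n) (Qubits n) ℂ) ψ) ^ 2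
    ∂((MeasureTheory.volume : MeasureTheory.Measure (Vec (Qubits n))).toSphere))

/-- Equality of unitaries up to a global phase. -/
def EqUpToPhase {n : ℕ} (U V : Unitaries n) : Prop :=
  ∃ z : ℂ, ‖z‖ = 1 ∧
    (U : Matrix (Qubits n) (Qubits n) ℂ) = z • (V : Matrix (Qubits n) (Qubits n) ℂ)

/-- The basis of two `n`-qubit systems (original system first, ancillary system second). -/
abbrev TwoQubits (n : ℕ) : Type := Qubits n × Qubits n

/-- `U ⊗ I`. -/
def localOp {n : ℕ} (U : Unitaries n) : Matrix (TwoQubits n) (TwoQubits n) ℂ :=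
  (U : Matrix (Qubits n) (Qubits n) ℂ) ⊗ₖ (1 : Matrix (Qubits n) (Qubits n) ℂ)

/-- `(U ⊗ I)|x⟩`. -/
def applyKet {n : ℕ} (U : Unitaries n) (x : Vec (TwoQubits n)) : Vec (TwoQubits n) :=
  Matrix.toEuclideanLin (localOp U) x

/-- `(U ⊗ I) ρ (U ⊗ I)†`. -/
def applyDensity {n : ℕ} (U : Unitaries n) (ρ : Matrix (TwoQubits n) (TwoQubits n) ℂ) :
    Matrix (TwoQubits n) (TwoQubits n) ℂ :=
  localOp U * ρ * (localOp U).conjTranspose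

/-- The Schmidt rank of a bipartite ket `∑ A i j |i⟩ ⊗ |j⟩`: the rank of `A`. -/
def schmidtRank {n : ℕ} (x : Vec (TwoQubits n)) : ℕ :=
  (Matrix.of fun i j : Qubits n => x (i, j)).rank

/-- Entangled inputs: normalized bipartite kets with Schmidt rank at most `r`. -/
def IsEntangledInput {n : ℕ} (r : ℕ) (x : Vec (TwoQubits n)) : Prop :=
  ‖x‖ = 1 ∧ schmidtRank x ≤ r

/-- Classically mixed inputs: states of the form `∑_{j<r} p j |φ j⟩⟨φ j| ⊗ |ψ j⟩⟨ψ j|`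
for a probability vector `p` and normalized kets `φ j`, `ψ j`. -/
def IsMixedInput {n : ℕ} (r : ℕ) (ρ : Matrix (TwoQubits n) (TwoQubits n) ℂ) : Prop :=
  ∃ (p : Fin r → ℝ) (φ ψ : Fin r → Vec (Qubits n)),
    (∀ j, 0 ≤ p j) ∧ ∑ j, p j = 1 ∧ (∀ j, ‖φ j‖ = 1) ∧ (∀ j, ‖ψ j‖ = 1) ∧
      ρ = ∑ j, (p j : ℂ) • (ketbra (φ j) ⊗ₖ ketbra (ψ j))

/-- Density matrices. -/
def IsDensity {ι : Type} [Fintype ι] (σ : Matrix ι ι ℂ) : Prop :=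
  σ.PosSemidef ∧ σ.trace = 1

abbrev EntangledInput (n r : ℕ) : Type := {x : Vec (TwoQubits n) // IsEntangledInput r x}

abbrev Ket (n : ℕ) : Type := {y : Vec (TwoQubits n) // ‖y‖ = 1}

abbrev MixedInput (n r : ℕ) : Type :=
  {ρ : Matrix (TwoQubits n) (TwoQubits n) ℂ // IsMixedInput r ρ}

abbrev Density (n : ℕ) : Type :=
  {σ : Matrix (TwoQubits n) (TwoQubits n) ℂ // IsDensity σ}

/-- A randomized, adaptive learning algorithm.  `Ω` is its internal randomness, `X` the set of
classically described inputs it may choose from, `Y` the set of classical descriptions it may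
receive.  Both the next input and the final hypothesis are arbitrary functions of the internal
randomness and of the input-output pairs collected so far. -/
structure Learner (n : ℕ) (X Y Ω : Type) where
  query : Ω → List (X × Y) → X
  guess : Ω → List (X × Y) → Unitaries n

/-- The first `k` input-output pairs collected when inputs `x` are answered by `O x`. -/
def Learner.data {n : ℕ} {X Y Ω : Type} (L : Learner n X Y Ω) (O : X → Y) (ω : Ω) :
    ℕ → List (X × Y)
  | 0 => []
  | k + 1 => L.data O ω k ++
      [(L.query ω (L.data O ω k), O (L.query ω (L.data O ω k)))]

/-- The hypothesis output after `N` input-output pairs. -/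
def Learner.output {n : ℕ} {X Y Ω : Type} (L : Learner n X Y Ω) (N : ℕ) (O : X → Y) (ω : Ω) :
    Unitaries n :=
  L.guess ω (L.data O ω N)

/-- For every unknown unitary `U` and every noisy source of data `O` for it (`Valid U x y` says
that `y` is an admissible noisy output on input `x`), the learner outputs, after `N` pairs and
with probability at least `2/3`, a hypothesis within `ε` of `U`. -/
def Learner.Learns {n : ℕ} {X Y Ω : Type} [MeasurableSpace Ω] (L : Learner n X Y Ω)
    (P : MeasureTheory.Measure Ω) (N : ℕ) (ε : ℝ) (Valid : Unitaries n → X → Y → Prop) : Prop :=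
  ∀ (U : Unitaries n) (O : X → Y), (∀ x, Valid U x (O x)) →
    ∃ E : Set Ω, MeasurableSet E ∧ 2 / 3 ≤ P E ∧ ∀ ω ∈ E, davg (L.output N O ω) U ≤ ε

/-- `y` is an `η`-noisy version of `(U ⊗ I)|x⟩`. -/
def EntangledNoisy {n r : ℕ} (η : ℝ) (U : Unitaries n) (x : EntangledInput n r) (y : Ket n) :
    Prop :=
  ketDist y.1 (applyKet U x.1) ≤ η

/-- `σ` is an `η`-noisy version of `(U ⊗ I) ρ (U ⊗ I)†`. -/
def MixedNoisy {n r : ℕ} (η : ℝ) (U : Unitaries n) (ρ : MixedInput n r) (σ : Density n) :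
    Prop :=
  traceDist σ.1 (applyDensity U ρ.1) ≤ η

end UnitaryLearning

end

open scoped Kronecker ComplexOrder

noncomputable section

namespace UnitaryLearning

/-! Write d for the dimension 2^n.

Upper bounds. The d anchor kets e_0 and e_0 + e_j all have inner product 1 with e_0. A unitary
preserves these inner products, so if its images of the anchors are known up to separate phases, all
these phases coincide and the unitary is known up to one phase (`eq_smul_of_anchorKet`). An input of
rank r carries r anchors, each marked by an orthogonal flag on the second factor, so ⌈d/r⌉ inputs
suffice.

Lower bounds. These rest on counting transcripts. `hard_family` provides unitaries U_p = α + β W_p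
with |β| ≤ 8ε such that every hypothesis is ε-close to at most a fraction 4 exp(-c d²) of them. For
a fixed input of rank r, the images under the U_p, or the component kets of these images, differ
only by terms of norm O(ε) in a space of complex dimension at most d r. A net at scale κε ≤ η
therefore has at most C^(2dr) points with C = 1 + 16/κ, whatever ε is (`exists_net`). A source that
answers with net points is admissible (`quantizable_entangledNoisy`, `quantizable_mixedNoisy`), and
against it a learner with fixed randomness sees at most C^(2drN) transcripts. Success probability
2/3 on the whole family forces C^(2drN) · 4 exp(-c d²) ≥ 2/3, that is, N ≥ const · d/r once d is
large. For the remaining n ≥ 1 with ε ≤ 1/3 it is enough that N ≠ 0.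

The hard family. The distance `davg` depends only on |tr(U†V)| (`davg_sq`), by the fourth moments of
a Haar-random state. Unitaries that are nearly uncorrelated with any given one come from choosing
columns successively as random sign combinations of k vectors orthogonal to the earlier columns; a
Chernoff bound then has exponent of order d². For small ε these unitaries become off-diagonal blocks
of Hermitian involutions H, and the family a + i b H with b = 4ε moves them into a small ball around
a multiple of the identity. -/

lemma conjTranspose_ketbra {ι : Type} (x : Vec ι) : (ketbra x).conjTranspose = ketbra x := by
  ext i j; simp [ketbra, Matrix.vecMulVec_apply, mul_comm]

/-! ### Trace distance of pure states and trace norm of sums of rank-one operators -/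

section TraceDistance

variable {ι : Type} [Fintype ι]

lemma inner_eq_star_dotProduct (x y : Vec ι) : inner ℂ x y = star x.ofLp ⬝ᵥ y.ofLp := by
  rw [EuclideanSpace.inner_eq_star_dotProduct, dotProduct_comm]

lemma star_dotProduct_self_of_norm_one {x : Vec ι} (hx : ‖x‖ = 1) :
    star x.ofLp ⬝ᵥ x.ofLp = 1 := by
  rw [← inner_eq_star_dotProduct, inner_self_eq_norm_sq_to_K, hx]; simp

lemma ketbra_mul_ketbra (x y : Vec ι) :
    ketbra x * ketbra y = inner ℂ x y • Matrix.vecMulVec x.ofLp (star y.ofLp) := by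
  rw [ketbra, ketbra, Matrix.vecMulVec_mul_vecMulVec, inner_eq_star_dotProduct,
    Matrix.vecMulVec_smul]

lemma ketbra_mul_self {x : Vec ι} (hx : ‖x‖ = 1) : ketbra x * ketbra x = ketbra x := by
  rw [ketbra_mul_ketbra, inner_eq_star_dotProduct, star_dotProduct_self_of_norm_one hx, one_smul,
    ketbra]

lemma ketbra_mul_ketbra_mul_ketbra (x y : Vec ι) :
    ketbra x * ketbra y * ketbra x = ((‖inner ℂ x y‖ ^ 2 : ℝ) : ℂ) • ketbra x := by
  rw [ketbra_mul_ketbra, Matrix.smul_mul, ketbra, Matrix.vecMulVec_mul_vecMulVec,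
    ← inner_eq_star_dotProduct, Matrix.vecMulVec_smul, smul_smul, ← inner_conj_symm y x,
    RCLike.mul_conj]
  simp

lemma trace_ketbra_mul_ketbra (x y : Vec ι) :
    (ketbra x * ketbra y).trace = ((‖inner ℂ x y‖ ^ 2 : ℝ) : ℂ) := by
  rw [ketbra_mul_ketbra, Matrix.trace_smul, Matrix.trace_vecMulVec, dotProduct_comm,
    ← inner_eq_star_dotProduct, ← inner_conj_symm y x, smul_eq_mul, RCLike.mul_conj]
  simp

lemma trace_ketbra {x : Vec ι} (hx : ‖x‖ = 1) : (ketbra x).trace = 1 := by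
  rw [ketbra, Matrix.trace_vecMulVec, dotProduct_comm, star_dotProduct_self_of_norm_one hx]

lemma norm_inner_le_one {x y : Vec ι} (hx : ‖x‖ = 1) (hy : ‖y‖ = 1) : ‖inner ℂ x y‖ ≤ 1 := by
  simpa [hx, hy] using norm_inner_le_norm (𝕜 := ℂ) x y

variable [DecidableEq ι]

/-- The trace distance of two pure states. -/
lemma ketDist_eq {x y : Vec ι} (hx : ‖x‖ = 1) (hy : ‖y‖ = 1) :
    ketDist x y = Real.sqrt (1 - ‖inner ℂ x y‖ ^ 2) := by
  set l : ℝ := 1 - ‖inner ℂ x y‖ ^ 2 with hl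
  have hl0 : 0 ≤ l := by
    have := norm_inner_le_one hx hy
    have h0 := norm_nonneg (inner ℂ x y)
    rw [hl]; nlinarith
  set X := ketbra x
  set Y := ketbra y
  have hXX : X * X = X := ketbra_mul_self hx
  have hYY : Y * Y = Y := ketbra_mul_self hy
  have hXYX : X * Y * X = ((‖inner ℂ x y‖ ^ 2 : ℝ) : ℂ) • X := ketbra_mul_ketbra_mul_ketbra x y
  have hYXY : Y * X * Y = ((‖inner ℂ x y‖ ^ 2 : ℝ) : ℂ) • Y := by
    rw [ketbra_mul_ketbra_mul_ketbra, norm_inner_symm]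
  set A := X - Y with hA
  have hAH : A.conjTranspose = A := by
    rw [hA, Matrix.conjTranspose_sub, conjTranspose_ketbra, conjTranspose_ketbra]
  have hB : A.conjTranspose * A = X - X * Y - Y * X + Y := by
    rw [hAH, hA, sub_mul, mul_sub, mul_sub, hXX, hYY]; abel
  have hlam : ((l : ℝ) : ℂ) = 1 - ((‖inner ℂ x y‖ ^ 2 : ℝ) : ℂ) := by rw [hl]; push_cast; rfl
  have hBX : (A.conjTranspose * A) * X = (l : ℂ) • X := by
    rw [hB, hlam, sub_smul, one_smul, ← hXYX]
    simp only [add_mul, sub_mul, mul_assoc, hXX]; abel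
  have hBY : (A.conjTranspose * A) * Y = (l : ℂ) • Y := by
    rw [hB, hlam, sub_smul, one_smul, ← hYXY]
    simp only [add_mul, sub_mul, mul_assoc, hYY]; abel
  have hBA : (A.conjTranspose * A) * A = (l : ℂ) • A := by
    conv_lhs => rw [hA, mul_sub, ← hA, hBX, hBY]
    rw [hA, smul_sub]
  have hBB : (A.conjTranspose * A) * (A.conjTranspose * A) = (l : ℂ) • (A.conjTranspose * A) := by
    conv_lhs => rw [hAH, ← mul_assoc]
    rw [hAH] at hBA ⊢
    rw [hBA, Matrix.smul_mul]
  have htr : (A.conjTranspose * A).trace = ((2 * l : ℝ) : ℂ) := by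
    rw [hB, Matrix.trace_add, Matrix.trace_sub, Matrix.trace_sub, Matrix.trace_mul_comm Y X,
      trace_ketbra hx, trace_ketbra hy, trace_ketbra_mul_ketbra, hl]
    push_cast; ring
  set h := Matrix.isHermitian_conjTranspose_mul_self A
  -- Since A†A acts as l on A, every eigenvalue of A†A is 0 or l. Together with the trace 2l this
  -- determines the trace norm, without computing the spectrum of A.
  have heig : ∀ i, h.eigenvalues i * h.eigenvalues i = l * h.eigenvalues i := by
    intro i
    have h1 := h.mulVec_eigenvectorBasis i
    have h2 : ((A.conjTranspose * A) * (A.conjTranspose * A)).mulVec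
        (h.eigenvectorBasis i).ofLp = (h.eigenvalues i * h.eigenvalues i) •
          (h.eigenvectorBasis i).ofLp := by
      rw [← Matrix.mulVec_mulVec, h1, Matrix.mulVec_smul, h1, smul_smul]
    rw [hBB, Matrix.smul_mulVec, h1] at h2
    have hne : (h.eigenvectorBasis i).ofLp ≠ 0 := by
      intro h0
      have := h.eigenvectorBasis.orthonormal.1 i
      rw [show h.eigenvectorBasis i = 0 from by ext j; simp [h0]] at this
      simp at this
    have h3 : (l * h.eigenvalues i) • (h.eigenvectorBasis i).ofLp =
        (h.eigenvalues i * h.eigenvalues i) • (h.eigenvectorBasis i).ofLp := by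
      rw [← h2, mul_smul]; rfl
    exact (smul_left_injective ℝ hne h3).symm
  have hsum : ∑ i, h.eigenvalues i = 2 * l := by
    have := h.trace_eq_sum_eigenvalues
    rw [htr] at this
    exact (Complex.ofReal_injective (by simpa using this)).symm
  have hT : traceNorm A * Real.sqrt l = 2 * l := by
    rw [← hsum, traceNorm, Finset.sum_mul]
    refine Finset.sum_congr rfl fun i _ => ?_
    rcases mul_eq_mul_right_iff.1 (heig i) with h1 | h1
    · rw [h1, Real.mul_self_sqrt hl0]
    · rw [h1]; simp
  rw [ketDist, traceDist]
  change traceNorm A / 2 = _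
  rcases hl0.eq_or_lt with h0 | h0
  · have : traceNorm A = 0 := by
      refine Finset.sum_eq_zero fun i _ => ?_
      have := heig i
      rw [← h0, zero_mul, mul_self_eq_zero] at this
      rw [this, Real.sqrt_zero]
    rw [this, ← h0]; simp
  · have hs : 0 < Real.sqrt l := Real.sqrt_pos.2 h0
    have h2 : traceNorm A * Real.sqrt l = 2 * Real.sqrt l * Real.sqrt l := by
      rw [hT, mul_assoc, Real.mul_self_sqrt hl0]
    rw [mul_right_cancel₀ hs.ne' h2]; ring

lemma ketDist_le_norm_sub {x y : Vec ι} (hx : ‖x‖ = 1) (hy : ‖y‖ = 1) :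
    ketDist x y ≤ ‖x - y‖ := by
  rw [ketDist_eq hx hy]
  refine Real.sqrt_le_iff.2 ⟨norm_nonneg _, ?_⟩
  have h1 := norm_inner_le_one hx hy
  have h2 : RCLike.re (inner ℂ x y) ≤ ‖inner ℂ x y‖ := RCLike.re_le_norm _
  rw [norm_sub_sq (𝕜 := ℂ), hx, hy]
  nlinarith [norm_nonneg (inner ℂ x y), sq_nonneg (1 - ‖inner ℂ x y‖)]

/-- The trace norm of a sum of rank one operators `c j • |a j⟩⟨b j|`. -/
lemma traceNorm_sum_vecMulVec_le {κ : Type*} [Fintype κ] (c : κ → ℝ) (a b : κ → Vec ι) :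
    traceNorm (∑ j, (c j : ℂ) • Matrix.vecMulVec (a j).ofLp (star (b j).ofLp)) ≤
      ∑ j, |c j| * (‖a j‖ * ‖b j‖) := by
  set A := ∑ j, (c j : ℂ) • Matrix.vecMulVec (a j).ofLp (star (b j).ofLp) with hA
  set h := Matrix.isHermitian_conjTranspose_mul_self A
  have hpos : ∀ i, 0 ≤ h.eigenvalues i :=
    (Matrix.posSemidef_conjTranspose_mul_self A).eigenvalues_nonneg
  set v := h.eigenvectorBasis
  set f : Vec ι → Vec ι := fun x => Matrix.toEuclideanLin A x with hf
  have hfa : ∀ x, f x = ∑ j, ((c j : ℂ) * inner ℂ (b j) x) • a j := by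
    intro x
    ext i
    simp only [hf, hA, Matrix.toLpLin_apply, Matrix.sum_mulVec, Matrix.smul_mulVec,
      Matrix.vecMulVec_mulVec, inner_eq_star_dotProduct]
    simp [mul_comm, mul_left_comm]
  have hin : ∀ i k, inner ℂ (f (v i)) (f (v k)) = if i = k then (h.eigenvalues i : ℂ) else 0 := by
    intro i k
    have h1 := h.mulVec_eigenvectorBasis k
    have h2 : inner ℂ (f (v i)) (f (v k)) = (h.eigenvalues k : ℂ) * inner ℂ (v i) (v k) := by
      simp only [inner_eq_star_dotProduct, hf, Matrix.toLpLin_apply]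
      rw [Matrix.star_mulVec, ← Matrix.dotProduct_mulVec, Matrix.mulVec_mulVec]
      change _ ⬝ᵥ (A.conjTranspose * A).mulVec (h.eigenvectorBasis k).ofLp = _
      rw [h1, dotProduct_smul, Complex.real_smul]
    rw [h2, orthonormal_iff_ite.1 v.orthonormal]
    split_ifs with hik
    · simp [hik]
    · simp
  let T : Type := {i : ι // h.eigenvalues i ≠ 0}
  -- The left singular vectors, for nonzero singular values only. Each such singular value is the
  -- matrix element of A between u i and v i, which is linear in the rank-one terms.
  let u : T → Vec ι := fun i => ((Real.sqrt (h.eigenvalues i.1))⁻¹ : ℂ) • f (v i.1)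
  have hsq : ∀ i, ((Real.sqrt (h.eigenvalues i) : ℝ) : ℂ) * (Real.sqrt (h.eigenvalues i) : ℝ) =
      h.eigenvalues i := fun i => by
    rw [← Complex.ofReal_mul, Real.mul_self_sqrt (hpos i)]
  have hs0 : ∀ i : T, ((Real.sqrt (h.eigenvalues i.1) : ℝ) : ℂ) ≠ 0 := fun i => by
    exact_mod_cast (Real.sqrt_pos.2 (lt_of_le_of_ne (hpos i.1) i.2.symm)).ne'
  have hu : Orthonormal ℂ u := by
    rw [orthonormal_iff_ite]
    intro i k
    have hik : i = k ↔ i.1 = k.1 := Subtype.ext_iff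
    simp only [u, inner_smul_left, inner_smul_right, hin, hik]
    split_ifs with hik
    · have := hs0 i
      rw [← hik, ← hsq]
      simp only [map_inv₀, Complex.conj_ofReal]
      field_simp
    · simp
  have hv : Orthonormal ℂ (fun i : T => v i.1) := v.orthonormal.comp _ Subtype.val_injective
  have hstep : traceNorm A = ∑ i : T, Real.sqrt (h.eigenvalues i.1) := by
    have h1 := Finset.sum_subtype (Finset.univ.filter fun i => h.eigenvalues i ≠ 0)
      (p := fun i => h.eigenvalues i ≠ 0) (F := (inferInstance : Fintype T)) (by simp)
      (fun i => Real.sqrt (h.eigenvalues i))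
    rw [← h1, Finset.sum_filter_of_ne]
    · rfl
    · intro i _ hi h0
      exact hi (by rw [h0, Real.sqrt_zero])
  have hterm : ∀ i : T, ((Real.sqrt (h.eigenvalues i.1) : ℝ) : ℂ) =
      ∑ j, (c j : ℂ) * (inner ℂ (b j) (v i.1) * inner ℂ (u i) (a j)) := by
    intro i
    have h1 : ((Real.sqrt (h.eigenvalues i.1) : ℝ) : ℂ) = inner ℂ (u i) (f (v i.1)) := by
      simp only [u, inner_smul_left, hin, if_true, map_inv₀, Complex.conj_ofReal]
      rw [← hsq]
      have := hs0 i
      field_simp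
    rw [h1, hfa, inner_sum]
    refine Finset.sum_congr rfl fun j _ => ?_
    rw [inner_smul_right]; ring
  -- Cauchy-Schwarz, followed by Bessel's inequality for each of the two orthonormal systems.
  have hCS : ∀ j, ∑ i : T, ‖inner ℂ (b j) (v i.1)‖ * ‖inner ℂ (u i) (a j)‖ ≤ ‖a j‖ * ‖b j‖ := by
    intro j
    refine (Real.sum_mul_le_sqrt_mul_sqrt _ _ _).trans ?_
    rw [mul_comm ‖a j‖]
    refine mul_le_mul ?_ ?_ (Real.sqrt_nonneg _) (norm_nonneg _)
    · refine Real.sqrt_le_iff.2 ⟨norm_nonneg _, ?_⟩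
      simp_rw [norm_inner_symm (b j)]
      exact hv.sum_inner_products_le (b j)
    · exact Real.sqrt_le_iff.2 ⟨norm_nonneg _, hu.sum_inner_products_le (a j)⟩
  calc traceNorm A = ∑ i : T, Real.sqrt (h.eigenvalues i.1) := hstep
    _ ≤ ∑ i : T, ∑ j, |c j| * (‖inner ℂ (b j) (v i.1)‖ * ‖inner ℂ (u i) (a j)‖) := by
        refine Finset.sum_le_sum fun i _ => ?_
        have h1 : Real.sqrt (h.eigenvalues i.1) =
            ‖((Real.sqrt (h.eigenvalues i.1) : ℝ) : ℂ)‖ := by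
          rw [Complex.norm_real, Real.norm_of_nonneg (Real.sqrt_nonneg _)]
        rw [h1, hterm i]
        refine (norm_sum_le _ _).trans (Finset.sum_le_sum fun j _ => ?_)
        rw [norm_mul, norm_mul, Complex.norm_real, Real.norm_eq_abs]
    _ = ∑ j, |c j| * ∑ i : T, ‖inner ℂ (b j) (v i.1)‖ * ‖inner ℂ (u i) (a j)‖ := by
        rw [Finset.sum_comm]; simp_rw [Finset.mul_sum]
    _ ≤ _ := Finset.sum_le_sum fun j _ => mul_le_mul_of_nonneg_left (hCS j) (abs_nonneg _)

end TraceDistance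

/-! ### Fourth moments of a Haar-random state -/

section HaarMoments

open MeasureTheory

variable {ι : Type} [Fintype ι]

/-- The surface measure of a set is, up to a constant, the Lebesgue volume of the cone over it. An
isometry preserves the volume and maps cones to cones. -/
lemma integral_sphere_comp_isometry (T : Vec ι ≃ₗᵢ[ℂ] Vec ι) (f : Vec ι → ℝ) :
    ∫ ψ : Metric.sphere (0 : Vec ι) 1, f (T ψ) ∂(volume : Measure (Vec ι)).toSphere =
      ∫ ψ : Metric.sphere (0 : Vec ι) 1, f ψ ∂(volume : Measure (Vec ι)).toSphere := by
  let g : Metric.sphere (0 : Vec ι) 1 ≃ₜ Metric.sphere (0 : Vec ι) 1 :=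
    { toFun := fun ψ => ⟨T ψ, by simp⟩
      invFun := fun ψ => ⟨T.symm ψ, by simp⟩
      left_inv := fun ψ => by simp
      right_inv := fun ψ => by simp
      continuous_toFun := by fun_prop
      continuous_invFun := by fun_prop }
  let T' : Vec ι ≃ₗᵢ[ℝ] Vec ι :=
    { T.toLinearEquiv.restrictScalars ℝ with norm_map' := fun x => T.norm_map x }
  have hT' : MeasurePreserving (T' : Vec ι → Vec ι) volume volume := T'.measurePreserving
  have hg : MeasurePreserving g.toMeasurableEquiv (volume : Measure (Vec ι)).toSphere
      (volume : Measure (Vec ι)).toSphere := by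
    refine ⟨g.measurable, ?_⟩
    ext s hs
    rw [Homeomorph.toMeasurableEquiv_coe, Measure.map_apply g.measurable hs,
      Measure.toSphere_apply' _ hs, Measure.toSphere_apply' _ (g.measurable hs)]
    congr 1
    conv_rhs =>
      rw [← hT'.measure_preimage_emb T'.toHomeomorph.toMeasurableEquiv.measurableEmbedding]
    congr 1
    ext x
    simp only [Set.mem_preimage, Set.mem_smul, Set.mem_image]
    constructor
    · rintro ⟨c, hc, _, ⟨ψ, hψ, rfl⟩, rfl⟩
      exact ⟨c, hc, _, ⟨g ψ, hψ, rfl⟩, (T'.map_smul c (ψ : Vec ι)).symm⟩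
    · rintro ⟨c, hc, _, ⟨ψ, hψ, rfl⟩, h⟩
      refine ⟨c, hc, _, ⟨g.symm ψ, by simpa using hψ, rfl⟩, ?_⟩
      apply T'.injective
      rw [← h]
      refine (T'.map_smul c _).trans ?_
      congr 1
      exact T.apply_symm_apply _
  exact hg.integral_comp' (fun ψ : Metric.sphere (0 : Vec ι) 1 => f ψ)

lemma integral_sphere_orthonormalBasis (v w : OrthonormalBasis ι ℂ (Vec ι))
    (f : (ι → ℂ) → ℝ) :
    ∫ ψ : Metric.sphere (0 : Vec ι) 1, f (fun i => inner ℂ (v i) (ψ : Vec ι))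
        ∂(volume : Measure (Vec ι)).toSphere =
      ∫ ψ : Metric.sphere (0 : Vec ι) 1, f (fun i => inner ℂ (w i) (ψ : Vec ι))
        ∂(volume : Measure (Vec ι)).toSphere := by
  rw [← integral_sphere_comp_isometry (v.repr.trans w.repr.symm)
    (fun ψ => f (fun i => inner ℂ (w i) ψ))]
  simp [← OrthonormalBasis.repr_apply_apply]

lemma integrable_sphere {f : Metric.sphere (0 : Vec ι) 1 → ℝ} (hf : Continuous f) :
    Integrable f (volume : Measure (Vec ι)).toSphere :=
  hf.integrable_of_hasCompactSupport (HasCompactSupport.of_compactSpace f)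

variable [DecidableEq ι]

lemma exists_orthonormalBasis_pair {i j : ι} (hij : i ≠ j) {x y : Vec ι} (hx : ‖x‖ = 1)
    (hy : ‖y‖ = 1) (hxy : inner ℂ x y = 0) :
    ∃ v : OrthonormalBasis ι ℂ (Vec ι), v i = x ∧ v j = y := by
  have hyx : inner ℂ y x = 0 := by rw [← inner_conj_symm, hxy, map_zero]
  obtain ⟨v, hv⟩ := Orthonormal.exists_orthonormalBasis_extension_of_card_eq (𝕜 := ℂ)
    (E := Vec ι) (by simp) (v := fun k => if k = i then x else y) (s := {i, j}) (by
      rw [orthonormal_iff_ite]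
      rintro ⟨k, hk⟩ ⟨l, hl⟩
      simp only [Set.mem_insert_iff, Set.mem_singleton_iff] at hk hl
      rcases hk with rfl | rfl <;> rcases hl with rfl | rfl <;>
        simp [Set.domRestrict, hij, hij.symm, hx, hy, hxy, hyx, inner_self_eq_norm_sq_to_K])
  exact ⟨v, by simpa using hv i (by simp), by simpa [hij.symm] using hv j (by simp)⟩

lemma integral_fourth_moment_eq (v w : OrthonormalBasis ι ℂ (Vec ι)) (i k : ι) :
    ∫ ψ : Metric.sphere (0 : Vec ι) 1, ‖inner ℂ (v i) (ψ : Vec ι)‖ ^ 4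
        ∂(volume : Measure (Vec ι)).toSphere =
      ∫ ψ : Metric.sphere (0 : Vec ι) 1, ‖inner ℂ (w k) (ψ : Vec ι)‖ ^ 4
        ∂(volume : Measure (Vec ι)).toSphere := by
  rw [integral_sphere_orthonormalBasis v (w.reindex (Equiv.swap i k)) (fun z => ‖z i‖ ^ 4)]
  simp

/-- The two products equal (|X|² + |Y|²)² minus 4 (Re X̄Y)² and 4 (Im X̄Y)² respectively, so in the
sum the phase-dependent terms combine to 4|X|²|Y|². -/
lemma norm_sq_mul_norm_sq_rotations (X Y : ℂ) :
    ‖X + Y‖ ^ 2 * ‖X - Y‖ ^ 2 + ‖X - Complex.I * Y‖ ^ 2 * ‖X + Complex.I * Y‖ ^ 2 =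
      2 * (‖X‖ ^ 4 + ‖Y‖ ^ 4) := by
  rw [show (4 : ℕ) = 2 * 2 from rfl, pow_mul, pow_mul]
  simp only [← Complex.normSq_eq_norm_sq, Complex.normSq_apply, Complex.add_re, Complex.add_im,
    Complex.sub_re, Complex.sub_im, Complex.mul_re, Complex.mul_im, Complex.I_re, Complex.I_im]
  ring

/-- Replacing v i, v j by (v i ± z v j)/√2 does not change the mixed moment. Adding the resulting
formulas for z = 1 and z = i leaves only pure fourth moments, which do not depend on the basis
vector. -/
lemma two_mul_integral_mixed_moment (v : OrthonormalBasis ι ℂ (Vec ι)) {i j : ι} (hij : i ≠ j) :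
    2 * ∫ ψ : Metric.sphere (0 : Vec ι) 1,
        ‖inner ℂ (v i) (ψ : Vec ι)‖ ^ 2 * ‖inner ℂ (v j) (ψ : Vec ι)‖ ^ 2
          ∂(volume : Measure (Vec ι)).toSphere =
      ∫ ψ : Metric.sphere (0 : Vec ι) 1, ‖inner ℂ (v i) (ψ : Vec ι)‖ ^ 4
        ∂(volume : Measure (Vec ι)).toSphere := by
  set s : ℂ := (((Real.sqrt 2)⁻¹ : ℝ) : ℂ) with hs
  have hs2 : ‖s‖ ^ 2 = 1 / 2 := by
    rw [hs, Complex.norm_real, Real.norm_of_nonneg (by positivity), inv_pow,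
      Real.sq_sqrt (by norm_num)]; norm_num
  have hi : inner ℂ (v i) (v i) = (1 : ℂ) := by simp
  have hj : inner ℂ (v j) (v j) = (1 : ℂ) := by simp
  have hvij : inner ℂ (v i) (v j) = (0 : ℂ) := by
    rw [orthonormal_iff_ite.1 v.orthonormal, if_neg hij]
  have hvji : inner ℂ (v j) (v i) = (0 : ℂ) := by
    rw [orthonormal_iff_ite.1 v.orthonormal, if_neg hij.symm]
  have hnorm : ∀ z : ℂ, ‖z‖ = 1 → ‖s • (v i + z • v j)‖ = 1 := by
    intro z hz
    have h1 : ‖v i + z • v j‖ ^ 2 = 2 := by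
      rw [norm_add_sq (𝕜 := ℂ), inner_smul_right, hvij, norm_smul, hz]
      simp; norm_num
    have h2 : ‖s • (v i + z • v j)‖ ^ 2 = 1 := by
      rw [norm_smul, mul_pow, h1, hs2]; norm_num
    exact (pow_eq_one_iff_of_nonneg (norm_nonneg _) two_ne_zero).1 h2
  have horth : ∀ z : ℂ, ‖z‖ = 1 →
      inner ℂ (s • (v i + z • v j)) (s • (v i + (-z) • v j)) = (0 : ℂ) := by
    intro z hz
    simp only [inner_smul_left, inner_smul_right, inner_add_left, inner_add_right, hi, hj, hvij,
      hvji]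
    have : (starRingEnd ℂ) z * z = 1 := by
      rw [RCLike.conj_mul, hz]; simp
    linear_combination (-((starRingEnd ℂ) s * s)) * this
  have key : ∀ z : ℂ, ‖z‖ = 1 →
      ∫ ψ : Metric.sphere (0 : Vec ι) 1,
        ‖inner ℂ (v i) (ψ : Vec ι)‖ ^ 2 * ‖inner ℂ (v j) (ψ : Vec ι)‖ ^ 2
          ∂(volume : Measure (Vec ι)).toSphere =
      ∫ ψ : Metric.sphere (0 : Vec ι) 1,
        (‖inner ℂ (v i) (ψ : Vec ι) + (starRingEnd ℂ) z * inner ℂ (v j) (ψ : Vec ι)‖ ^ 2 *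
          ‖inner ℂ (v i) (ψ : Vec ι) - (starRingEnd ℂ) z * inner ℂ (v j) (ψ : Vec ι)‖ ^ 2) / 4
          ∂(volume : Measure (Vec ι)).toSphere := by
    intro z hz
    obtain ⟨w, hwi, hwj⟩ := exists_orthonormalBasis_pair hij (hnorm z hz)
      (hnorm (-z) (by rwa [norm_neg])) (horth z hz)
    rw [integral_sphere_orthonormalBasis v w (fun t => ‖t i‖ ^ 2 * ‖t j‖ ^ 2)]
    refine integral_congr_ae (Filter.Eventually.of_forall fun ψ => ?_)
    simp only [hwi, hwj, inner_smul_left, inner_add_left, norm_mul, mul_pow, RCLike.norm_conj,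
      hs2, map_neg, neg_mul, ← sub_eq_add_neg]
    ring
  have h1 := key 1 (by simp)
  have h2 := key Complex.I (by simp)
  have h4 := integral_fourth_moment_eq v v i j
  have hc : ∀ k, Continuous fun ψ : Metric.sphere (0 : Vec ι) 1 => inner ℂ (v k) (ψ : Vec ι) :=
    fun k => by fun_prop
  have hci := hc i
  have hcj := hc j
  rw [two_mul]
  nth_rw 1 [h1]
  rw [h2, ← integral_add (integrable_sphere (by fun_prop)) (integrable_sphere (by fun_prop))]
  have h5 : ∀ ψ : Metric.sphere (0 : Vec ι) 1,
      (‖inner ℂ (v i) (ψ : Vec ι) + (starRingEnd ℂ) 1 * inner ℂ (v j) (ψ : Vec ι)‖ ^ 2 *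
          ‖inner ℂ (v i) (ψ : Vec ι) - (starRingEnd ℂ) 1 * inner ℂ (v j) (ψ : Vec ι)‖ ^ 2) / 4 +
      (‖inner ℂ (v i) (ψ : Vec ι) +
          (starRingEnd ℂ) Complex.I * inner ℂ (v j) (ψ : Vec ι)‖ ^ 2 *
          ‖inner ℂ (v i) (ψ : Vec ι) -
            (starRingEnd ℂ) Complex.I * inner ℂ (v j) (ψ : Vec ι)‖ ^ 2) / 4 =
      (‖inner ℂ (v i) (ψ : Vec ι)‖ ^ 4 + ‖inner ℂ (v j) (ψ : Vec ι)‖ ^ 4) / 2 := by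
    intro ψ
    have := norm_sq_mul_norm_sq_rotations (inner ℂ (v i) (ψ : Vec ι)) (inner ℂ (v j) (ψ : Vec ι))
    simp only [map_one, one_mul, Complex.conj_I, neg_mul, ← sub_eq_add_neg, sub_neg_eq_add]
    linarith
  simp_rw [h5]
  rw [integral_div, integral_add (integrable_sphere (by fun_prop))
    (integrable_sphere (by fun_prop)), ← h4]
  ring

/-- The mixed fourth moments of the coordinates of a (not normalized) Haar-random state. -/
lemma exists_integral_moments : ∃ β : ℝ, ∀ (v : OrthonormalBasis ι ℂ (Vec ι)) (i j : ι),
    ∫ ψ : Metric.sphere (0 : Vec ι) 1,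
        ‖inner ℂ (v i) (ψ : Vec ι)‖ ^ 2 * ‖inner ℂ (v j) (ψ : Vec ι)‖ ^ 2
          ∂(volume : Measure (Vec ι)).toSphere = β * (1 + if i = j then 1 else 0) := by
  rcases isEmpty_or_nonempty ι with h | ⟨⟨k⟩⟩
  · exact ⟨0, fun _ i => isEmptyElim i⟩
  let w : OrthonormalBasis ι ℂ (Vec ι) := EuclideanSpace.basisFun ι ℂ
  refine ⟨(∫ ψ : Metric.sphere (0 : Vec ι) 1, ‖inner ℂ (w k) (ψ : Vec ι)‖ ^ 4
        ∂(volume : Measure (Vec ι)).toSphere) / 2, fun v i j => ?_⟩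
  rw [integral_fourth_moment_eq w v k i]
  split_ifs with hij
  · subst hij
    rw [show (1 + 1 : ℝ) = 2 by norm_num, div_mul_cancel₀ _ two_ne_zero]
    refine integral_congr_ae (Filter.Eventually.of_forall fun ψ => ?_)
    simp only; ring
  · rw [← two_mul_integral_mixed_moment v hij]; ring

lemma trace_mul_self_of_isHermitian {A : Matrix ι ι ℂ} (hA : A.IsHermitian) :
    (A * A).trace = ((∑ i, hA.eigenvalues i ^ 2 : ℝ) : ℂ) := by
  have h := hA.spectral_theorem
  have h2 : A * A = (Unitary.conjStarAlgAut ℂ (Matrix ι ι ℂ)) hA.eigenvectorUnitary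
      (Matrix.diagonal (RCLike.ofReal ∘ hA.eigenvalues) *
        Matrix.diagonal (RCLike.ofReal ∘ hA.eigenvalues)) := by
    rw [map_mul, ← h]
  rw [h2, Unitary.conjStarAlgAut_apply, Matrix.trace_mul_comm, ← mul_assoc,
    Unitary.coe_star_mul_self, one_mul, Matrix.diagonal_mul_diagonal, Matrix.trace_diagonal]
  simp [pow_two]

/-- In an eigenbasis the form is ∑ λ_i |ψ_i|². The moments of its square give β (∑_{i,j} λ_i λ_j +
∑_i λ_i²). -/
lemma integral_quadratic_form_sq {β : ℝ} (hβ : ∀ (v : OrthonormalBasis ι ℂ (Vec ι)) (i j : ι),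
    ∫ ψ : Metric.sphere (0 : Vec ι) 1,
        ‖inner ℂ (v i) (ψ : Vec ι)‖ ^ 2 * ‖inner ℂ (v j) (ψ : Vec ι)‖ ^ 2
          ∂(volume : Measure (Vec ι)).toSphere = β * (1 + if i = j then 1 else 0))
    {A : Matrix ι ι ℂ} (hA : A.IsHermitian) :
    ∫ ψ : Metric.sphere (0 : Vec ι) 1,
        (inner ℂ (ψ : Vec ι) (Matrix.toEuclideanLin A (ψ : Vec ι))).re ^ 2
          ∂(volume : Measure (Vec ι)).toSphere = β * (A.trace.re ^ 2 + (A * A).trace.re) := by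
  set v := hA.eigenvectorBasis
  have hq : ∀ ψ : Vec ι, (inner ℂ ψ (Matrix.toEuclideanLin A ψ)).re =
      ∑ i, hA.eigenvalues i * ‖inner ℂ (v i) ψ‖ ^ 2 := by
    intro ψ
    have h1 : Matrix.toEuclideanLin A ψ =
        ∑ i, inner ℂ (v i) ψ • (hA.eigenvalues i : ℂ) • v i := by
      conv_lhs => rw [← v.sum_repr' ψ]
      rw [map_sum]
      refine Finset.sum_congr rfl fun i _ => ?_
      rw [map_smul]
      congr 1
      ext k
      have := congrFun (hA.mulVec_eigenvectorBasis i) k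
      simpa using this
    rw [h1, inner_sum, Complex.re_sum]
    refine Finset.sum_congr rfl fun i _ => ?_
    rw [inner_smul_right, inner_smul_right, ← inner_conj_symm ψ (v i), mul_left_comm,
      RCLike.mul_conj]
    norm_cast
    exact Complex.re_ofReal_mul _ _
  have hc : ∀ k, Continuous fun ψ : Metric.sphere (0 : Vec ι) 1 => inner ℂ (v k) (ψ : Vec ι) :=
    fun k => by fun_prop
  have hexp : ∀ ψ : Metric.sphere (0 : Vec ι) 1,
      (inner ℂ (ψ : Vec ι) (Matrix.toEuclideanLin A (ψ : Vec ι))).re ^ 2 =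
        ∑ i, ∑ j, hA.eigenvalues i * hA.eigenvalues j *
          (‖inner ℂ (v i) (ψ : Vec ι)‖ ^ 2 * ‖inner ℂ (v j) (ψ : Vec ι)‖ ^ 2) := by
    intro ψ
    rw [hq, pow_two, Finset.sum_mul_sum]
    exact Finset.sum_congr rfl fun i _ => Finset.sum_congr rfl fun j _ => by ring
  simp_rw [hexp]
  have hint : ∀ i, ∫ ψ : Metric.sphere (0 : Vec ι) 1,
      ∑ j, hA.eigenvalues i * hA.eigenvalues j *
          (‖inner ℂ (v i) (ψ : Vec ι)‖ ^ 2 * ‖inner ℂ (v j) (ψ : Vec ι)‖ ^ 2)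
          ∂(volume : Measure (Vec ι)).toSphere =
      ∑ j, hA.eigenvalues i * hA.eigenvalues j * (β * (1 + if i = j then 1 else 0)) := by
    intro i
    rw [integral_finsetSum _ fun j _ => integrable_sphere (by fun_prop)]
    exact Finset.sum_congr rfl fun j _ => by rw [integral_const_mul, hβ]
  rw [integral_finsetSum _ fun i _ => integrable_sphere (by fun_prop)]
  simp_rw [hint]
  have htr : A.trace.re = ∑ i, hA.eigenvalues i := by
    rw [hA.trace_eq_sum_eigenvalues]; simp
  rw [htr, trace_mul_self_of_isHermitian hA, Complex.ofReal_re, pow_two, Finset.sum_mul_sum,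
    ← Finset.sum_add_distrib, Finset.mul_sum]
  refine Finset.sum_congr rfl fun i _ => ?_
  simp only [mul_add, mul_one, mul_ite, mul_zero, Finset.sum_add_distrib, Finset.sum_ite_eq,
    Finset.mem_univ, if_true, Finset.mul_sum]
  congr 1
  · exact Finset.sum_congr rfl fun j _ => by ring
  · ring

/-- Split A = X + iY with X and Y Hermitian. Their forms are the real and imaginary parts of the
form of A, so the squared modulus reduces to two Hermitian cases. -/
lemma integral_norm_sq_quadratic_form (A : Matrix ι ι ℂ) {β : ℝ}
    (hβ : ∀ (v : OrthonormalBasis ι ℂ (Vec ι)) (i j : ι),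
    ∫ ψ : Metric.sphere (0 : Vec ι) 1,
        ‖inner ℂ (v i) (ψ : Vec ι)‖ ^ 2 * ‖inner ℂ (v j) (ψ : Vec ι)‖ ^ 2
          ∂(volume : Measure (Vec ι)).toSphere = β * (1 + if i = j then 1 else 0)) :
    ∫ ψ : Metric.sphere (0 : Vec ι) 1,
        ‖inner ℂ (ψ : Vec ι) (Matrix.toEuclideanLin A (ψ : Vec ι))‖ ^ 2
          ∂(volume : Measure (Vec ι)).toSphere =
      β * (‖A.trace‖ ^ 2 + (A.conjTranspose * A).trace.re) := by
  set X : Matrix ι ι ℂ := (1 / 2 : ℂ) • (A + A.conjTranspose) with hX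
  set Y : Matrix ι ι ℂ := (-Complex.I / 2) • (A - A.conjTranspose) with hY
  have hXh : X.IsHermitian := by
    rw [Matrix.IsHermitian, hX, Matrix.conjTranspose_smul, Matrix.conjTranspose_add,
      Matrix.conjTranspose_conjTranspose, add_comm]
    simp
  have hYh : Y.IsHermitian := by
    rw [Matrix.IsHermitian, hY, Matrix.conjTranspose_smul, Matrix.conjTranspose_sub,
      Matrix.conjTranspose_conjTranspose, ← neg_sub A, smul_neg, ← neg_smul]
    simp [neg_div]
  have hAXY : A = X + Complex.I • Y := by
    rw [hX, hY, smul_smul, show Complex.I * (-Complex.I / 2) = 1 / 2 by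
      linear_combination (-1 / 2 : ℂ) * Complex.I_mul_I, ← smul_add]
    rw [show A + A.conjTranspose + (A - A.conjTranspose) = (2 : ℂ) • A by rw [two_smul]; abel,
      smul_smul]
    norm_num
  have hreal : ∀ {B : Matrix ι ι ℂ}, B.IsHermitian → ∀ ψ : Vec ι,
      (inner ℂ ψ (Matrix.toEuclideanLin B ψ)).im = 0 := by
    intro B hB ψ
    have h1 : inner ℂ ψ (Matrix.toEuclideanLin B ψ) = inner ℂ (Matrix.toEuclideanLin B ψ) ψ := by
      rw [inner_eq_star_dotProduct, inner_eq_star_dotProduct, Matrix.toLpLin_apply,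
        Matrix.star_mulVec, hB.eq, Matrix.dotProduct_mulVec]
    refine Complex.conj_eq_iff_im.1 ?_
    rw [inner_conj_symm, h1]
  have hpt : ∀ ψ : Metric.sphere (0 : Vec ι) 1,
      ‖inner ℂ (ψ : Vec ι) (Matrix.toEuclideanLin A (ψ : Vec ι))‖ ^ 2 =
        (inner ℂ (ψ : Vec ι) (Matrix.toEuclideanLin X (ψ : Vec ι))).re ^ 2 +
        (inner ℂ (ψ : Vec ι) (Matrix.toEuclideanLin Y (ψ : Vec ι))).re ^ 2 := by
    intro ψ
    have hX0 := hreal hXh ψ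
    have hY0 := hreal hYh ψ
    clear_value X Y
    rw [hAXY, map_add, map_smul, LinearMap.add_apply, LinearMap.smul_apply, inner_add_right,
      inner_smul_right, ← Complex.normSq_eq_norm_sq, Complex.normSq_apply]
    simp only [Complex.add_re, Complex.add_im, Complex.mul_re, Complex.mul_im, Complex.I_re,
      Complex.I_im, hX0, hY0]
    ring
  have hcont : ∀ B : Matrix ι ι ℂ, Continuous fun ψ : Metric.sphere (0 : Vec ι) 1 =>
      (inner ℂ (ψ : Vec ι) (Matrix.toEuclideanLin B (ψ : Vec ι))).re ^ 2 := by
    intro B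
    have : Continuous (Matrix.toEuclideanLin B) := LinearMap.continuous_of_finiteDimensional _
    exact (Complex.continuous_re.comp (continuous_subtype_val.inner
      (this.comp continuous_subtype_val))).pow 2
  simp_rw [hpt]
  rw [integral_add (integrable_sphere (hcont X)) (integrable_sphere (hcont Y)),
    integral_quadratic_form_sq hβ hXh, integral_quadratic_form_sq hβ hYh]
  have h1 : X.trace = (A.trace.re : ℂ) := by
    rw [hX, Matrix.trace_smul, Matrix.trace_add, Matrix.trace_conjTranspose]
    apply Complex.ext <;> simp; ring
  have h2 : Y.trace = (A.trace.im : ℂ) := by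
    rw [hY, Matrix.trace_smul, Matrix.trace_sub, Matrix.trace_conjTranspose]
    apply Complex.ext <;> simp [neg_div]; ring
  have h3 : (X * X).trace + (Y * Y).trace = (A.conjTranspose * A).trace := by
    have e1 : X * X + Y * Y = (1 / 2 : ℂ) • (A * A.conjTranspose + A.conjTranspose * A) := by
      rw [hX, hY]
      rw [Matrix.smul_mul, Matrix.mul_smul, smul_smul, Matrix.smul_mul, Matrix.mul_smul, smul_smul,
        show -Complex.I / 2 * (-Complex.I / 2) = -(1 / 4) by
          linear_combination (1 / 4 : ℂ) * Complex.I_mul_I]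
      simp only [mul_add, mul_sub, add_mul, sub_mul]
      module
    rw [← Matrix.trace_add, e1, Matrix.trace_smul, Matrix.trace_add, Matrix.trace_mul_comm A,
      smul_eq_mul]
    ring
  rw [h1, h2, ← h3, Complex.add_re, Complex.ofReal_re, Complex.ofReal_re,
    ← Complex.normSq_eq_norm_sq, Complex.normSq_apply]
  ring

/-- The case A = 1, where the integrand is constantly 1, fixes the normalization of β. -/
lemma moment_constant_mul_card [Nonempty ι] {β : ℝ}
    (hβ : ∀ (v : OrthonormalBasis ι ℂ (Vec ι)) (i j : ι),
    ∫ ψ : Metric.sphere (0 : Vec ι) 1,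
        ‖inner ℂ (v i) (ψ : Vec ι)‖ ^ 2 * ‖inner ℂ (v j) (ψ : Vec ι)‖ ^ 2
          ∂(volume : Measure (Vec ι)).toSphere = β * (1 + if i = j then 1 else 0)) :
    β * (Fintype.card ι * (Fintype.card ι + 1)) =
      (volume : Measure (Vec ι)).toSphere.real Set.univ := by
  have h := integral_norm_sq_quadratic_form (1 : Matrix ι ι ℂ) hβ
  have h1 : ∀ ψ : Metric.sphere (0 : Vec ι) 1,
      ‖inner ℂ (ψ : Vec ι) (Matrix.toEuclideanLin (1 : Matrix ι ι ℂ) (ψ : Vec ι))‖ ^ 2 = 1 := by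
    intro ψ
    have : ‖(ψ : Vec ι)‖ = 1 := by simp
    simp [inner_self_eq_norm_sq_to_K, this]
  simp_rw [h1] at h
  rw [integral_const, smul_eq_mul, mul_one] at h
  rw [h, mul_one, Matrix.conjTranspose_one, Matrix.trace_one]
  simp only [Complex.norm_natCast, Complex.natCast_re]
  ring

/-- The second moment of the expectation value of an observable in a Haar-random state. -/
lemma average_norm_sq_quadratic_form [Nonempty ι] (A : Matrix ι ι ℂ) :
    ⨍ ψ : Metric.sphere (0 : Vec ι) 1,
        ‖inner ℂ (ψ : Vec ι) (Matrix.toEuclideanLin A (ψ : Vec ι))‖ ^ 2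
          ∂(volume : Measure (Vec ι)).toSphere =
      (‖A.trace‖ ^ 2 + (A.conjTranspose * A).trace.re) /
        (Fintype.card ι * (Fintype.card ι + 1)) := by
  obtain ⟨β, hβ⟩ := exists_integral_moments (ι := ι)
  have hv := moment_constant_mul_card hβ
  have hpos : 0 < (volume : Measure (Vec ι)).toSphere.real Set.univ := by
    have : (volume : Measure (Vec ι)).toSphere ≠ 0 := Measure.toSphere_ne_zero _
    have : NeZero (volume : Measure (Vec ι)).toSphere := ⟨this⟩
    exact measureReal_univ_pos
  rw [average_eq, integral_norm_sq_quadratic_form A hβ, ← hv, smul_eq_mul]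
  have hβ0 : β ≠ 0 := by rintro rfl; rw [zero_mul] at hv; exact hpos.ne hv
  have hd : (Fintype.card ι : ℝ) ≠ 0 := by simp
  field_simp

end HaarMoments

/-! ### The average-case distance as a function of the trace -/

lemma inner_toEuclideanLin_unitary {ι : Type} [Fintype ι] [DecidableEq ι]
    (U : Matrix.unitaryGroup ι ℂ) (x y : Vec ι) :
    inner ℂ (Matrix.toEuclideanLin (U : Matrix ι ι ℂ) x)
      (Matrix.toEuclideanLin (U : Matrix ι ι ℂ) y) = inner ℂ x y := by
  rw [inner_eq_star_dotProduct, inner_eq_star_dotProduct, Matrix.toLpLin_apply,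
    Matrix.toLpLin_apply, Matrix.star_mulVec, ← Matrix.dotProduct_mulVec, Matrix.mulVec_mulVec,
    ← Matrix.star_eq_conjTranspose, Unitary.coe_star_mul_self, Matrix.one_mulVec]

lemma norm_toEuclideanLin_unitary {ι : Type} [Fintype ι] [DecidableEq ι]
    (U : Matrix.unitaryGroup ι ℂ) (x : Vec ι) :
    ‖Matrix.toEuclideanLin (U : Matrix ι ι ℂ) x‖ = ‖x‖ := by
  have := congrArg Complex.re (inner_toEuclideanLin_unitary U x x)
  simp only [inner_self_eq_norm_sq_to_K] at this
  norm_cast at this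
  exact (sq_eq_sq₀ (norm_nonneg _) (norm_nonneg _)).1 this

/-- The average-case distance in terms of the normalized trace. -/
lemma davg_sq {n : ℕ} (U V : Unitaries n) :
    davg U V ^ 2 = 1 - (‖((U : Matrix (Qubits n) (Qubits n) ℂ).conjTranspose *
      (V : Matrix (Qubits n) (Qubits n) ℂ)).trace‖ ^ 2 + 2 ^ n) / (2 ^ n * (2 ^ n + 1)) := by
  set A := (U : Matrix (Qubits n) (Qubits n) ℂ).conjTranspose *
    (V : Matrix (Qubits n) (Qubits n) ℂ) with hA
  have hAA : A.conjTranspose * A = 1 := by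
    rw [hA, Matrix.conjTranspose_mul, Matrix.conjTranspose_conjTranspose, mul_assoc,
      ← mul_assoc (U : Matrix (Qubits n) (Qubits n) ℂ), ← Matrix.star_eq_conjTranspose,
      ← Matrix.star_eq_conjTranspose, Unitary.mul_star_self_of_mem U.2, one_mul,
      Unitary.star_mul_self_of_mem V.2]
  have hpt : ∀ ψ : Metric.sphere (0 : Vec (Qubits n)) 1,
      ketDist (Matrix.toEuclideanLin (U : Matrix (Qubits n) (Qubits n) ℂ) ψ)
        (Matrix.toEuclideanLin (V : Matrix (Qubits n) (Qubits n) ℂ) ψ) ^ 2 =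
      1 - ‖inner ℂ (ψ : Vec (Qubits n)) (Matrix.toEuclideanLin A (ψ : Vec (Qubits n)))‖ ^ 2 := by
    intro ψ
    have hψ : ‖(ψ : Vec (Qubits n))‖ = 1 := by simp
    have hU := (norm_toEuclideanLin_unitary U ψ).trans hψ
    have hV := (norm_toEuclideanLin_unitary V ψ).trans hψ
    rw [ketDist_eq hU hV, Real.sq_sqrt]
    · congr 3
      rw [inner_eq_star_dotProduct, inner_eq_star_dotProduct, Matrix.toLpLin_apply,
        Matrix.toLpLin_apply, Matrix.toLpLin_apply, Matrix.star_mulVec,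
        ← Matrix.dotProduct_mulVec, Matrix.mulVec_mulVec]
    · have := norm_inner_le_one hU hV
      nlinarith [norm_nonneg (inner ℂ (Matrix.toEuclideanLin
        (U : Matrix (Qubits n) (Qubits n) ℂ) (ψ : Vec (Qubits n)))
        (Matrix.toEuclideanLin (V : Matrix (Qubits n) (Qubits n) ℂ) (ψ : Vec (Qubits n))))]
  rw [davg, Real.sq_sqrt]
  · simp_rw [hpt]
    have hcont : Continuous fun ψ : Metric.sphere (0 : Vec (Qubits n)) 1 =>
        ‖inner ℂ (ψ : Vec (Qubits n)) (Matrix.toEuclideanLin A (ψ : Vec (Qubits n)))‖ ^ 2 := by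
      have : Continuous (Matrix.toEuclideanLin A) := LinearMap.continuous_of_finiteDimensional _
      exact ((continuous_subtype_val.inner (this.comp continuous_subtype_val)).norm).pow 2
    have hne : (MeasureTheory.volume : MeasureTheory.Measure (Vec (Qubits n))).toSphere ≠ 0 :=
      MeasureTheory.Measure.toSphere_ne_zero _
    have : NeZero (MeasureTheory.volume : MeasureTheory.Measure (Vec (Qubits n))).toSphere :=
      ⟨hne⟩
    have h1 := average_norm_sq_quadratic_form A
    rw [MeasureTheory.average_eq] at h1
    rw [MeasureTheory.average_eq, MeasureTheory.integral_sub (MeasureTheory.integrable_const _)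
      (integrable_sphere hcont), smul_sub, h1, hAA, Matrix.trace_one]
    have hpos : 0 < (MeasureTheory.volume :
        MeasureTheory.Measure (Vec (Qubits n))).toSphere.real Set.univ :=
      MeasureTheory.measureReal_univ_pos
    rw [MeasureTheory.integral_const, smul_smul, inv_mul_cancel₀ hpos.ne', one_smul]
    have h2 : ((2 : ℂ) ^ n).re = 2 ^ n := by
      rw [show (2 : ℂ) ^ n = ((2 ^ n : ℝ) : ℂ) by push_cast; rfl, Complex.ofReal_re]
    simp [h2]
  · rw [MeasureTheory.average_eq]
    exact smul_nonneg (by positivity) (MeasureTheory.integral_nonneg fun _ => sq_nonneg _)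

/-! ### Many nearly uncorrelated unitaries -/

section RandomUnitaries

/-- The sum over sign patterns factors into ∏ 2 cosh(a_i), and cosh x ≤ exp(x²/2). -/
lemma sum_exp_sum_sign_le {k : ℕ} (a : Fin k → ℝ) :
    ∑ s : Fin k → Bool, Real.exp (∑ i, (if s i then a i else -a i)) ≤
      2 ^ k * Real.exp ((∑ i, a i ^ 2) / 2) := by
  have h1 : ∑ s : Fin k → Bool, Real.exp (∑ i, (if s i then a i else -a i)) =
      ∏ i, (2 * Real.cosh (a i)) := by
    simp_rw [Real.exp_sum]
    rw [← Fintype.piFinset_univ,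
      ← Finset.prod_univ_sum (fun _ => Finset.univ) (fun i (b : Bool) =>
        Real.exp (if b then a i else -a i))]
    refine Finset.prod_congr rfl fun i _ => ?_
    rw [Fintype.sum_bool, Real.cosh_eq]
    simp
    ring
  rw [h1, Finset.prod_mul_distrib, Finset.sum_div, Real.exp_sum]
  simp only [Finset.prod_const, Finset.card_univ, Fintype.card_fin]
  refine mul_le_mul_of_nonneg_left ?_ (by positivity)
  exact Finset.prod_le_prod (fun i _ => (Real.cosh_pos _).le)
    fun i _ => Real.cosh_le_exp_half_sq _

variable {E : Type} [NormedAddCommGroup E] [InnerProductSpace ℂ E] [FiniteDimensional ℂ E]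

lemma exists_orthonormal_orthogonal {m k : ℕ} (hmk : m + k ≤ Module.finrank ℂ E)
    {u : Fin m → E} (hu : Orthonormal ℂ u) :
    ∃ b : Fin k → E, Orthonormal ℂ b ∧ ∀ i j, inner ℂ (u i) (b j) = 0 := by
  set S := Submodule.span ℂ (Set.range u)
  have hS : Module.finrank ℂ S = m := by
    rw [finrank_span_eq_card hu.linearIndependent, Fintype.card_fin]
  have hSo : k ≤ Module.finrank ℂ Sᗮ := by
    have := S.finrank_add_finrank_orthogonal
    omega
  let c := stdOrthonormalBasis ℂ Sᗮ
  refine ⟨fun j => (c (Fin.castLE hSo j) : E), ?_, fun i j => ?_⟩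
  · have := c.orthonormal.comp _ (Fin.castLE_injective hSo)
    exact this.comp_linearIsometry Sᗮ.subtypeₗᵢ
  · exact (Submodule.mem_orthogonal _ _).1 (c (Fin.castLE hSo j)).2 _
      (Submodule.subset_span ⟨i, rfl⟩)

/-- A finite family of orthonormal systems in which each vector is a random sign combination of
`k` orthonormal vectors that are orthogonal to the previous ones. -/
lemma exists_orthonormal_tower {k : ℕ} (hk : 0 < k) (m : ℕ) (hmk : m + k ≤ Module.finrank ℂ E) :
    ∃ (I : Type) (_ : Fintype I) (_ : Nonempty I) (u : I → Fin m → E),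
      (∀ p, Orthonormal ℂ (u p)) ∧
      ∀ w : Fin m → E, (∀ j, ‖w j‖ ≤ 1) → ∀ l : ℝ,
        ∑ p, Real.exp (l * ∑ j, (inner ℂ (w j) (u p j)).re) ≤
          Fintype.card I * Real.exp (m * (l ^ 2 / (2 * k))) := by
  induction m with
  | zero =>
    refine ⟨Unit, inferInstance, inferInstance, fun _ j => j.elim0,
      fun _ => ⟨fun j => j.elim0, fun j => j.elim0⟩, fun w _ l => by simp⟩
  | succ m ih =>
    obtain ⟨I, _, _, u, hu, hI⟩ := ih (by omega)
    choose b hb hub using fun p => exists_orthonormal_orthogonal (m := m) (k := k) (by omega) (hu p)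
    have hk0 : (0 : ℝ) < k := by exact_mod_cast hk
    set r : ℝ := (Real.sqrt k)⁻¹ with hr
    have hr2 : r ^ 2 = 1 / k := by rw [hr, inv_pow, Real.sq_sqrt hk0.le, one_div]
    let sg : Bool → ℂ := fun c => if c then (r : ℂ) else -(r : ℂ)
    have hsg : ∀ c, ‖sg c‖ ^ 2 = 1 / k := by
      intro c
      rw [← hr2]
      cases c <;> simp [sg]
    let y : I → (Fin k → Bool) → E := fun p s => ∑ i, sg (s i) • b p i
    have hy : ∀ p s, ‖y p s‖ = 1 := by
      intro p s
      have h1 : ‖y p s‖ ^ 2 = 1 := by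
        have h2 : inner ℂ (y p s) (y p s) = ∑ i, (starRingEnd ℂ) (sg (s i)) * sg (s i) :=
          (hb p).inner_sum _ _ _
        have h3 : ∀ i, (starRingEnd ℂ) (sg (s i)) * sg (s i) = ((1 / k : ℝ) : ℂ) := by
          intro i; rw [RCLike.conj_mul, ← hsg (s i)]; norm_cast
        rw [inner_self_eq_norm_sq_to_K] at h2
        simp_rw [h3] at h2
        rw [Finset.sum_const, Finset.card_univ, Fintype.card_fin, nsmul_eq_mul] at h2
        have h4 : (k : ℝ) * (1 / k) = 1 := by field_simp
        have h5 : ((‖y p s‖ ^ 2 : ℝ) : ℂ) = ((k * (1 / k) : ℝ) : ℂ) := by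
          push_cast at h2 ⊢; exact h2
        rw [← h4]; exact_mod_cast h5
      exact (pow_eq_one_iff_of_nonneg (norm_nonneg _) two_ne_zero).1 h1
    have huy : ∀ p s j, inner ℂ (u p j) (y p s) = 0 := by
      intro p s j
      simp only [y, inner_sum, inner_smul_right, hub, mul_zero, Finset.sum_const_zero]
    refine ⟨I × (Fin k → Bool), inferInstance, inferInstance,
      fun q => Fin.snoc (u q.1) (y q.1 q.2), fun q => ⟨fun j => ?_, fun i j hij => ?_⟩,
      fun w hw l => ?_⟩
    · refine Fin.lastCases ?_ (fun j => ?_) j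
      · simp [hy]
      · simpa using (hu q.1).1 j
    · induction i using Fin.lastCases with
      | last =>
        induction j using Fin.lastCases with
        | last => exact absurd rfl hij
        | cast j =>
          simp only [Fin.snoc_last, Fin.snoc_castSucc]
          rw [← inner_conj_symm, huy, map_zero]
      | cast i =>
        induction j using Fin.lastCases with
        | last => simp [huy]
        | cast j =>
          simp only [Fin.snoc_castSucc]
          exact (hu q.1).2 fun h => hij (by rw [h])
    -- With the earlier vectors fixed, the new one contributes a sign sum with coefficients l r
    -- Re⟨w, b_i⟩. By Bessel their squares sum to at most l²/k, uniformly in the earlier choices, so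
    -- the moment bound picks up one factor per column.
    · have hlast : ∀ p, ∑ s : Fin k → Bool,
          Real.exp (l * (inner ℂ (w (Fin.last m)) (y p s)).re) ≤
            2 ^ k * Real.exp (l ^ 2 / (2 * k)) := by
        intro p
        set a : Fin k → ℝ := fun i => l * (r * (inner ℂ (w (Fin.last m)) (b p i)).re) with ha
        have h1 : ∀ s : Fin k → Bool, l * (inner ℂ (w (Fin.last m)) (y p s)).re =
            ∑ i, (if s i then a i else -a i) := by
          intro s
          simp only [y, inner_sum, inner_smul_right, Complex.re_sum, Finset.mul_sum]
          refine Finset.sum_congr rfl fun i _ => ?_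
          cases s i <;> simp [sg, ha]
        simp_rw [h1]
        refine (sum_exp_sum_sign_le a).trans ?_
        refine mul_le_mul_of_nonneg_left (Real.exp_le_exp.2 ?_) (by positivity)
        have h2 : ∑ i, (inner ℂ (w (Fin.last m)) (b p i)).re ^ 2 ≤ 1 := by
          have h3 := (hb p).sum_inner_products_le (w (Fin.last m)) (s := Finset.univ)
          have h4 : ‖w (Fin.last m)‖ ^ 2 ≤ 1 := pow_le_one₀ (norm_nonneg _) (hw _)
          refine le_trans (Finset.sum_le_sum fun i _ => ?_) (h3.trans h4)
          rw [norm_inner_symm, ← sq_abs]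
          exact pow_le_pow_left₀ (abs_nonneg _) (Complex.abs_re_le_norm _) 2
        have h5 : ∑ i, a i ^ 2 =
            l ^ 2 * (1 / k) * ∑ i, (inner ℂ (w (Fin.last m)) (b p i)).re ^ 2 := by
          rw [Finset.mul_sum, ← hr2]
          exact Finset.sum_congr rfl fun i _ => by rw [ha]; ring
        rw [h5]
        have h6 : 0 ≤ l ^ 2 * (1 / k : ℝ) := by positivity
        have h7 : l ^ 2 / (2 * k) = l ^ 2 * (1 / k : ℝ) / 2 := by field_simp
        rw [h7]
        nlinarith
      calc ∑ q : I × (Fin k → Bool), Real.exp (l * ∑ j,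
            (inner ℂ (w j) (Fin.snoc (α := fun _ => E) (u q.1) (y q.1 q.2) j)).re)
          = ∑ p, Real.exp (l * ∑ j, (inner ℂ (w (Fin.castSucc j)) (u p j)).re) *
              ∑ s : Fin k → Bool, Real.exp (l * (inner ℂ (w (Fin.last m)) (y p s)).re) := by
            rw [Fintype.sum_prod_type]
            refine Finset.sum_congr rfl fun p _ => ?_
            rw [Finset.mul_sum]
            refine Finset.sum_congr rfl fun s _ => ?_
            rw [← Real.exp_add, Fin.sum_univ_castSucc, mul_add]
            simp
        _ ≤ ∑ p, Real.exp (l * ∑ j, (inner ℂ (w (Fin.castSucc j)) (u p j)).re) *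
              (2 ^ k * Real.exp (l ^ 2 / (2 * k))) :=
            Finset.sum_le_sum fun p _ => mul_le_mul_of_nonneg_left (hlast p) (Real.exp_pos _).le
        _ ≤ (Fintype.card I * Real.exp (m * (l ^ 2 / (2 * k)))) *
              (2 ^ k * Real.exp (l ^ 2 / (2 * k))) := by
            rw [← Finset.sum_mul]
            exact mul_le_mul_of_nonneg_right (hI _ (fun j => hw _) l) (by positivity)
        _ = _ := by
            rw [Fintype.card_prod, Fintype.card_fun, Fintype.card_bool, Fintype.card_fin]
            push_cast
            rw [add_mul, Real.exp_add, one_mul]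
            ring

lemma matrix_of_orthonormalBasis_mem {ι : Type} [Fintype ι] [DecidableEq ι]
    (b : OrthonormalBasis ι ℂ (Vec ι)) :
    (Matrix.of fun i j => b j i) ∈ Matrix.unitaryGroup ι ℂ := by
  rw [Matrix.mem_unitaryGroup_iff']
  ext j l
  have := orthonormal_iff_ite.1 b.orthonormal j l
  rw [inner_eq_star_dotProduct] at this
  rw [Matrix.mul_apply, Matrix.one_apply, ← this]
  rfl

lemma norm_column_unitary {ι : Type} [Fintype ι] [DecidableEq ι] (W : Matrix.unitaryGroup ι ℂ)
    (j : ι) : ‖(WithLp.toLp 2 fun i => (W : Matrix ι ι ℂ) i j : Vec ι)‖ = 1 := by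
  have h0 : (W : Matrix ι ι ℂ).conjTranspose * (W : Matrix ι ι ℂ) = 1 :=
    Unitary.star_mul_self_of_mem W.2
  have h : ((W : Matrix ι ι ℂ).conjTranspose * (W : Matrix ι ι ℂ)) j j = 1 := by
    rw [h0, Matrix.one_apply_eq]
  have h2 : inner ℂ (WithLp.toLp 2 fun i => (W : Matrix ι ι ℂ) i j : Vec ι)
      (WithLp.toLp 2 fun i => (W : Matrix ι ι ℂ) i j) = 1 := by
    rw [inner_eq_star_dotProduct, ← h]
    rfl
  rw [inner_self_eq_norm_sq_to_K] at h2
  have h3 : ‖(WithLp.toLp 2 fun i => (W : Matrix ι ι ℂ) i j : Vec ι)‖ ^ 2 = 1 := by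
    exact Complex.ofReal_injective (by simpa using h2)
  exact (pow_eq_one_iff_of_nonneg (norm_nonneg _) two_ne_zero).1 h3

/-- Only m columns are random, since each random column needs k free orthogonal directions. The
other k columns are an arbitrary completion and add at most k to the trace, which is the term l k.
-/
lemma exists_unitary_family_exp {m k : ℕ} (hk : 0 < k) :
    ∃ (I : Type) (_ : Fintype I) (_ : Nonempty I)
      (V : I → Matrix.unitaryGroup (Fin (m + k)) ℂ),
      ∀ (W : Matrix.unitaryGroup (Fin (m + k)) ℂ) (l : ℝ), 0 ≤ l →
        ∑ p, Real.exp (l * ((W : Matrix (Fin (m + k)) (Fin (m + k)) ℂ).conjTranspose *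
          (V p : Matrix (Fin (m + k)) (Fin (m + k)) ℂ)).trace.re) ≤
          Fintype.card I * Real.exp (m * (l ^ 2 / (2 * k)) + l * k) := by
  obtain ⟨I, hI1, hI2, u, hu, hI⟩ := exists_orthonormal_tower (E := Vec (Fin (m + k))) hk m (by simp)
  have hext : ∀ p, ∃ b : OrthonormalBasis (Fin (m + k)) ℂ (Vec (Fin (m + k))),
      ∀ j, b (Fin.castAdd k j) = u p j := by
    intro p
    obtain ⟨b, hb⟩ := Orthonormal.exists_orthonormalBasis_extension_of_card_eq (𝕜 := ℂ)
      (E := Vec (Fin (m + k))) (ι := Fin (m + k)) (by simp)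
      (v := Fin.addCases (u p) (fun _ => 0)) (s := Set.range (Fin.castAdd k)) (by
        rw [orthonormal_iff_ite]
        rintro ⟨_, i, rfl⟩ ⟨_, j, rfl⟩
        simpa [Set.domRestrict, Subtype.ext_iff] using orthonormal_iff_ite.1 (hu p) i j)
    exact ⟨b, fun j => by simpa using hb _ ⟨j, rfl⟩⟩
  choose b hb using hext
  refine ⟨I, hI1, hI2, fun p => ⟨_, matrix_of_orthonormalBasis_mem (b p)⟩, fun W l hl => ?_⟩
  let w : Fin (m + k) → Vec (Fin (m + k)) := fun j =>
    WithLp.toLp 2 fun i => (W : Matrix (Fin (m + k)) (Fin (m + k)) ℂ) i j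
  have htr : ∀ p, ((W : Matrix (Fin (m + k)) (Fin (m + k)) ℂ).conjTranspose *
      (Matrix.of fun i j => b p j i)).trace.re ≤
        ∑ j, (inner ℂ (w (Fin.castAdd k j)) (u p j)).re + k := by
    intro p
    have h1 : ((W : Matrix (Fin (m + k)) (Fin (m + k)) ℂ).conjTranspose *
        (Matrix.of fun i j => b p j i)).trace = ∑ j, inner ℂ (w j) (b p j) := by
      rw [Matrix.trace]
      refine Finset.sum_congr rfl fun j _ => ?_
      rw [inner_eq_star_dotProduct]
      rfl
    rw [h1, Fin.sum_univ_add, Complex.add_re, Complex.re_sum]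
    simp_rw [hb]
    gcongr
    rw [Complex.re_sum]
    calc ∑ i, (inner ℂ (w (Fin.natAdd m i)) (b p (Fin.natAdd m i))).re ≤ ∑ _i : Fin k, (1 : ℝ) := by
          refine Finset.sum_le_sum fun i _ => (Complex.re_le_norm _).trans ?_
          exact norm_inner_le_one (norm_column_unitary W _) ((b p).orthonormal.1 _)
      _ = k := by simp
  calc _ ≤ ∑ p, Real.exp (l * ∑ j, (inner ℂ (w (Fin.castAdd k j)) (u p j)).re) *
        Real.exp (l * k) := by
        refine Finset.sum_le_sum fun p _ => ?_
        rw [← Real.exp_add, ← mul_add]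
        exact Real.exp_le_exp.2 (mul_le_mul_of_nonneg_left (htr p) hl)
    _ ≤ (Fintype.card I * Real.exp (m * (l ^ 2 / (2 * k)))) * Real.exp (l * k) := by
        rw [← Finset.sum_mul]
        exact mul_le_mul_of_nonneg_right
          (hI _ (fun j => (norm_column_unitary W _).le) l) (Real.exp_pos _).le
    _ = _ := by rw [mul_assoc, ← Real.exp_add]

/-- Exponentially many (in the square of the dimension) nearly uncorrelated unitaries. -/
lemma exists_unitary_family {t : ℝ} (ht : 0 < t) (ht1 : t ≤ 1) {d : ℕ} (hd : 4 ≤ t * d) :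
    ∃ (I : Type) (_ : Fintype I) (_ : Nonempty I) (V : I → Matrix.unitaryGroup (Fin d) ℂ),
      ∀ W : Matrix.unitaryGroup (Fin d) ℂ,
        ((Finset.univ.filter fun p => t * d ≤ ((W : Matrix (Fin d) (Fin d) ℂ).conjTranspose *
          (V p : Matrix (Fin d) (Fin d) ℂ)).trace.re).card : ℝ) ≤
          Real.exp (-(t ^ 3 / 32 * (d : ℝ) ^ 2)) * Fintype.card I := by
  -- The k columns that are not random then use up at most half of the threshold t d. From t d ≥ 4
  -- the rounding still leaves k ≥ t d / 4.
  obtain ⟨k, hk⟩ : ∃ k : ℕ, k = ⌊t * d / 2⌋₊ := ⟨_, rfl⟩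
  have hk1 : (k : ℝ) ≤ t * d / 2 := hk ▸ Nat.floor_le (by linarith)
  have hk2 : t * d / 2 < k + 1 := hk ▸ Nat.lt_floor_add_one _
  have hk3 : t * d / 4 ≤ k := by linarith
  have hk0 : (0 : ℝ) < k := by linarith
  have hd0 : (0 : ℝ) < d := by
    rcases Nat.eq_zero_or_pos d with h | h
    · rw [h] at hd; norm_num at hd
    · exact_mod_cast h
  have hkd : k ≤ d := by
    have : (k : ℝ) ≤ d := by nlinarith
    exact_mod_cast this
  obtain ⟨m, rfl⟩ : ∃ m, d = m + k := ⟨d - k, by omega⟩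
  obtain ⟨I, hI1, hI2, V, hV⟩ := exists_unitary_family_exp (m := m) (k := k) (by exact_mod_cast hk0)
  refine ⟨I, hI1, hI2, V, fun W => ?_⟩
  set F := Finset.univ.filter fun p => t * ((m + k : ℕ) : ℝ) ≤
    ((W : Matrix (Fin (m + k)) (Fin (m + k)) ℂ).conjTranspose *
          (V p : Matrix (Fin (m + k)) (Fin (m + k)) ℂ)).trace.re with hF
  obtain ⟨D, hD⟩ : ∃ D : ℝ, D = ((m + k : ℕ) : ℝ) := ⟨_, rfl⟩
  rw [← hD] at hk1 hk2 hk3 hd0 ⊢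
  -- The Chernoff parameter minimizing D l²/(2k) - l t D/2. The minimum is -t² k D/8 ≤ -t³ D²/32.
  obtain ⟨l, hl⟩ : ∃ l : ℝ, l = t * k / 2 := ⟨_, rfl⟩
  have hl0 : 0 ≤ l := by rw [hl]; positivity
  have hmD : (m : ℝ) ≤ D := by rw [hD]; push_cast; linarith
  have h1 : (F.card : ℝ) * Real.exp (l * (t * D)) ≤
      Fintype.card I * Real.exp (m * (l ^ 2 / (2 * k)) + l * k) := by
    refine le_trans ?_ (hV W l hl0)
    rw [← nsmul_eq_mul]
    refine (Finset.card_nsmul_le_sum F _ _ fun p hp => ?_).trans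
      (Finset.sum_le_univ_sum_of_nonneg fun p => (Real.exp_pos _).le)
    refine Real.exp_le_exp.2 (mul_le_mul_of_nonneg_left ?_ hl0)
    rw [hD]
    exact (Finset.mem_filter.1 hp).2
  have h2 : m * (l ^ 2 / (2 * k)) + l * k ≤ l * (t * D) + -(t ^ 3 / 32 * D ^ 2) := by
    have e1 : l ^ 2 / (2 * k) = t ^ 2 * k / 8 := by rw [hl]; field_simp; ring
    rw [e1]
    have e2 : m * (t ^ 2 * k / 8) ≤ D * (t ^ 2 * k / 8) :=
      mul_le_mul_of_nonneg_right hmD (by positivity)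
    have e3 : l * k ≤ l * (t * D / 2) := mul_le_mul_of_nonneg_left hk1 hl0
    have e4 : t ^ 2 * D / 8 * (t * D / 4) ≤ t ^ 2 * D / 8 * k :=
      mul_le_mul_of_nonneg_left hk3 (by positivity)
    have e5 : l * (t * D) = t ^ 2 * D / 2 * k := by rw [hl]; ring
    nlinarith
  have h3 : (F.card : ℝ) * Real.exp (l * (t * D)) ≤
      (Real.exp (-(t ^ 3 / 32 * D ^ 2)) * Fintype.card I) * Real.exp (l * (t * D)) := by
    refine h1.trans ?_
    rw [mul_comm (Real.exp _) (Fintype.card I : ℝ), mul_assoc, ← Real.exp_add]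
    refine mul_le_mul_of_nonneg_left (Real.exp_le_exp.2 ?_) (by positivity)
    linarith
  exact le_of_mul_le_mul_right h3 (Real.exp_pos _)

end RandomUnitaries

/-! ### Families of unitaries that are hard to learn -/

section HardFamily

lemma davg_nonneg {n : ℕ} (U V : Unitaries n) : 0 ≤ davg U V := Real.sqrt_nonneg _

lemma norm_trace_sq_ge_of_davg_le {n : ℕ} {U V : Unitaries n} {ε : ℝ} (h : davg U V ≤ ε) :
    (2 ^ n) ^ 2 - ε ^ 2 * (2 ^ n * (2 ^ n + 1)) ≤
      ‖((U : Matrix (Qubits n) (Qubits n) ℂ).conjTranspose *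
        (V : Matrix (Qubits n) (Qubits n) ℂ)).trace‖ ^ 2 := by
  have h1 : davg U V ^ 2 ≤ ε ^ 2 := pow_le_pow_left₀ (davg_nonneg U V) h 2
  rw [davg_sq] at h1
  have hd : (0 : ℝ) < 2 ^ n * (2 ^ n + 1) := by positivity
  have h2 := mul_le_mul_of_nonneg_right h1 hd.le
  rw [sub_mul, div_mul_cancel₀ _ hd.ne'] at h2
  nlinarith

lemma exists_phase_norm_sub_sq {E : Type*} [NormedAddCommGroup E] [InnerProductSpace ℂ E]
    (a b : E) : ∃ z : ℂ, ‖z‖ = 1 ∧ ‖a - z • b‖ ^ 2 = ‖a‖ ^ 2 - 2 * ‖inner ℂ a b‖ + ‖b‖ ^ 2 := by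
  obtain ⟨z, hz, hzi⟩ : ∃ z : ℂ, ‖z‖ = 1 ∧ z * inner ℂ a b = ‖inner ℂ a b‖ := by
    by_cases h : inner ℂ a b = 0
    · exact ⟨1, by simp, by simp [h]⟩
    · have hn : ((‖inner ℂ a b‖ : ℝ) : ℂ) ≠ 0 := by simpa using h
      refine ⟨(starRingEnd ℂ) (inner ℂ a b) / ‖inner ℂ a b‖, ?_, ?_⟩
      · rw [norm_div, RCLike.norm_conj, Complex.norm_real, norm_norm,
          div_self (norm_ne_zero_iff.2 h)]
      · rw [div_mul_eq_mul_div, RCLike.conj_mul, div_eq_iff hn]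
        exact pow_two _
  refine ⟨z, hz, ?_⟩
  rw [norm_sub_sq (𝕜 := ℂ), inner_smul_right, hzi, norm_smul, hz, one_mul]
  simp

/-- A triangle inequality for the distance modulo phases. Both b and c, suitably rephased, have
squared distance at most 2Ds from a, hence at most 8Ds from each other. -/
lemma norm_inner_ge_of_norm_inner_ge {E : Type*} [NormedAddCommGroup E] [InnerProductSpace ℂ E]
    {a b c : E} {D s : ℝ} (ha : ‖a‖ ^ 2 = D) (hb : ‖b‖ ^ 2 = D) (hc : ‖c‖ ^ 2 = D)
    (hab : D * (1 - s) ≤ ‖inner ℂ a b‖) (hac : D * (1 - s) ≤ ‖inner ℂ a c‖) :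
    D * (1 - 4 * s) ≤ ‖inner ℂ b c‖ := by
  obtain ⟨z, hz, hzb⟩ := exists_phase_norm_sub_sq a b
  obtain ⟨w, hw, hwc⟩ := exists_phase_norm_sub_sq a c
  have h1 : ‖z • b - w • c‖ ^ 2 ≤ 2 * (‖a - z • b‖ ^ 2 + ‖a - w • c‖ ^ 2) := by
    have h2 : ‖z • b - w • c‖ ≤ ‖a - z • b‖ + ‖a - w • c‖ := by
      rw [show z • b - w • c = (a - w • c) - (a - z • b) by abel, add_comm]
      exact norm_sub_le _ _
    nlinarith [norm_nonneg (z • b - w • c), sq_nonneg (‖a - z • b‖ - ‖a - w • c‖)]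
  have h3 : 2 * D - 2 * ‖inner ℂ b c‖ ≤ ‖z • b - w • c‖ ^ 2 := by
    rw [norm_sub_sq (𝕜 := ℂ), norm_smul, norm_smul, hz, hw, one_mul, one_mul, hb, hc]
    have h4 : RCLike.re (inner ℂ (z • b) (w • c)) ≤ ‖inner ℂ b c‖ := by
      refine (RCLike.re_le_norm _).trans ?_
      rw [inner_smul_left, inner_smul_right, norm_mul, norm_mul, RCLike.norm_conj, hz, hw]
      simp
    linarith
  rw [hzb, hwc, ha, hb, hc] at h1
  linarith

/-- The Hermitian unitary with off-diagonal blocks `V` and `Vᴴ`. -/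
def blockHermitian {ι κ : Type} (e : ι ⊕ ι ≃ κ) (V : Matrix ι ι ℂ) : Matrix κ κ ℂ :=
  Matrix.reindex e e (Matrix.fromBlocks 0 V V.conjTranspose 0)

lemma blockHermitian_conjTranspose {ι κ : Type} (e : ι ⊕ ι ≃ κ) (V : Matrix ι ι ℂ) :
    (blockHermitian e V).conjTranspose = blockHermitian e V := by
  rw [blockHermitian, Matrix.conjTranspose_reindex, Matrix.fromBlocks_conjTranspose]
  simp

variable {ι : Type} [Fintype ι]

/-- A matrix as a vector. -/
def flatten {ι : Type} (A : Matrix ι ι ℂ) : Vec (ι × ι) := WithLp.toLp 2 fun q => A q.1 q.2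

lemma inner_flatten (A B : Matrix ι ι ℂ) :
    inner ℂ (flatten A) (flatten B) = (A.conjTranspose * B).trace := by
  rw [inner_eq_star_dotProduct, dotProduct, Fintype.sum_prod_type, Finset.sum_comm]
  rfl

lemma blockHermitian_mul {κ : Type} [Fintype κ] (e : ι ⊕ ι ≃ κ) (V W : Matrix ι ι ℂ) :
    blockHermitian e V * blockHermitian e W =
      Matrix.reindex e e (Matrix.fromBlocks (V * W.conjTranspose) 0 0 (V.conjTranspose * W)) := by
  rw [blockHermitian, blockHermitian, Matrix.reindex_apply, Matrix.reindex_apply,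
    Matrix.submatrix_mul_equiv, Matrix.fromBlocks_multiply]
  simp

lemma trace_reindex_sum {κ : Type} [Fintype κ] (e : ι ⊕ ι ≃ κ) (A : Matrix (ι ⊕ ι) (ι ⊕ ι) ℂ) :
    (Matrix.reindex e e A).trace = A.trace := by
  rw [Matrix.trace, Matrix.trace]
  exact Fintype.sum_equiv e.symm _ _ fun i => rfl

lemma trace_blockHermitian {κ : Type} [Fintype κ] (e : ι ⊕ ι ≃ κ) (V : Matrix ι ι ℂ) :
    (blockHermitian e V).trace = 0 := by
  rw [blockHermitian, trace_reindex_sum, Matrix.trace]; simp [Fintype.sum_sum_type]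

/-- The two diagonal blocks of the product have complex conjugate traces. The trace is therefore
real, so control of the real part of tr(V†W) suffices for this construction. -/
lemma trace_blockHermitian_mul {κ : Type} [Fintype κ] (e : ι ⊕ ι ≃ κ) (V W : Matrix ι ι ℂ) :
    (blockHermitian e V * blockHermitian e W).trace =
      ((2 * (V.conjTranspose * W).trace.re : ℝ) : ℂ) := by
  rw [blockHermitian_mul, trace_reindex_sum]
  have h0 : (Matrix.fromBlocks (V * W.conjTranspose) 0 0 (V.conjTranspose * W)).trace =
      (V * W.conjTranspose).trace + (V.conjTranspose * W).trace := by
    simp [Matrix.trace, Fintype.sum_sum_type]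
  rw [h0]
  have h : (V * W.conjTranspose).trace = star (V.conjTranspose * W).trace := by
    rw [← Matrix.trace_conjTranspose, Matrix.conjTranspose_mul, Matrix.conjTranspose_conjTranspose,
      Matrix.trace_mul_comm]
  rw [h]
  apply Complex.ext <;> simp
  ring

variable [DecidableEq ι]

lemma norm_flatten_sq (U : Matrix.unitaryGroup ι ℂ) :
    ‖flatten (U : Matrix ι ι ℂ)‖ ^ 2 = Fintype.card ι := by
  have h := inner_flatten (U : Matrix ι ι ℂ) (U : Matrix ι ι ℂ)
  rw [show (U : Matrix ι ι ℂ).conjTranspose * (U : Matrix ι ι ℂ) = 1 from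
    Unitary.star_mul_self_of_mem U.2, inner_self_eq_norm_sq_to_K, Matrix.trace_one] at h
  exact Complex.ofReal_injective (by simpa using h)

lemma norm_trace_unitary_le (U V : Matrix.unitaryGroup ι ℂ) :
    ‖((U : Matrix ι ι ℂ).conjTranspose * (V : Matrix ι ι ℂ)).trace‖ ≤ Fintype.card ι := by
  rw [← inner_flatten]
  refine (norm_inner_le_norm _ _).trans ?_
  nlinarith [norm_flatten_sq U, norm_flatten_sq V,
    sq_nonneg (‖flatten (U : Matrix ι ι ℂ)‖ - ‖flatten (V : Matrix ι ι ℂ)‖)]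

lemma smul_mem_unitaryGroup {z : ℂ} (hz : ‖z‖ = 1) (U : Matrix.unitaryGroup ι ℂ) :
    z • (U : Matrix ι ι ℂ) ∈ Matrix.unitaryGroup ι ℂ := by
  rw [Matrix.mem_unitaryGroup_iff', star_smul, Matrix.smul_mul, Matrix.mul_smul, smul_smul,
    Unitary.star_mul_self_of_mem U.2]
  rw [show star z * z = 1 by rw [RCLike.star_def, RCLike.conj_mul, hz]; simp, one_smul]

lemma affine_hermitian_mem_unitaryGroup {H : Matrix ι ι ℂ} (hH : H.conjTranspose = H)
    (hHH : H * H = 1) {a b : ℝ} (hab : a ^ 2 + b ^ 2 = 1) :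
    (a : ℂ) • (1 : Matrix ι ι ℂ) + ((b : ℂ) * Complex.I) • H ∈ Matrix.unitaryGroup ι ℂ := by
  rw [Matrix.mem_unitaryGroup_iff', Matrix.star_eq_conjTranspose, Matrix.conjTranspose_add,
    Matrix.conjTranspose_smul, Matrix.conjTranspose_smul, Matrix.conjTranspose_one, hH]
  have h1 : star ((b : ℂ) * Complex.I) = -((b : ℂ) * Complex.I) := by simp
  have h2 : star (a : ℂ) = a := by simp
  have h3 : ((a : ℂ)) ^ 2 + (b : ℂ) ^ 2 = 1 := by exact_mod_cast hab
  rw [h1, h2]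
  simp only [add_mul, mul_add, Matrix.smul_mul, Matrix.mul_smul, hHH, mul_one, one_mul]
  have h4 : ((a : ℂ) * a) - ((b : ℂ) * Complex.I) * ((b : ℂ) * Complex.I) = 1 := by
    linear_combination h3 - (b : ℂ) ^ 2 * Complex.I_mul_I
  calc _ = ((a : ℂ) * a - ((b : ℂ) * Complex.I) * ((b : ℂ) * Complex.I)) • (1 : Matrix ι ι ℂ) := by
        module
    _ = 1 := by rw [h4, one_smul]

lemma trace_affine_hermitian {H K : Matrix ι ι ℂ} (hH : H.conjTranspose = H)
    (hH0 : H.trace = 0) (hK0 : K.trace = 0) (a b : ℝ) :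
    (((a : ℂ) • (1 : Matrix ι ι ℂ) + ((b : ℂ) * Complex.I) • H).conjTranspose *
      ((a : ℂ) • (1 : Matrix ι ι ℂ) + ((b : ℂ) * Complex.I) • K)).trace =
      (a : ℂ) ^ 2 * Fintype.card ι + (b : ℂ) ^ 2 * (H * K).trace := by
  have h1 : star ((b : ℂ) * Complex.I) = -((b : ℂ) * Complex.I) := by simp
  have h2 : star (a : ℂ) = a := by simp
  rw [Matrix.conjTranspose_add, Matrix.conjTranspose_smul, Matrix.conjTranspose_smul,
    Matrix.conjTranspose_one, hH, h1, h2]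
  simp only [add_mul, mul_add, Matrix.smul_mul, Matrix.mul_smul, mul_one, one_mul,
    Matrix.trace_add, Matrix.trace_smul, hH0, hK0, Matrix.trace_one, smul_eq_mul]
  linear_combination (-(b : ℂ) ^ 2 * (H * K).trace) * Complex.I_mul_I

lemma blockHermitian_mul_self {κ : Type} [Fintype κ] [DecidableEq κ] (e : ι ⊕ ι ≃ κ)
    (V : Matrix.unitaryGroup ι ℂ) :
    blockHermitian e (V : Matrix ι ι ℂ) * blockHermitian e (V : Matrix ι ι ℂ) = 1 := by
  rw [blockHermitian_mul, ← Matrix.star_eq_conjTranspose, Unitary.star_mul_self_of_mem V.2,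
    Unitary.mul_star_self_of_mem V.2, Matrix.fromBlocks_one]
  simp

/-- Closeness to V forces |tr(V†U_p)| ≥ √2 t d, so one of ± its real part and ± its imaginary part
is at least t d. The real-part bound is applied to V, -V, iV and -iV, whence the factor 4. -/
lemma hard_family_large {ε₀ : ℝ} (h0 : 0 ≤ ε₀) (h1 : ε₀ < 1) :
    ∃ c : ℝ, 0 < c ∧ ∃ n₁ : ℕ, ∀ n, n₁ ≤ n → ∃ (I : Type) (_ : Fintype I) (_ : Nonempty I)
      (U : I → Unitaries n), ∀ (ε : ℝ), 0 ≤ ε → ε ≤ ε₀ → ∀ V : Unitaries n,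
        ((Finset.univ.filter fun p => davg V (U p) ≤ ε).card : ℝ) ≤
          4 * Real.exp (-(c * (2 ^ n) ^ 2)) * Fintype.card I := by
  classical
  obtain ⟨g, hg⟩ : ∃ g : ℝ, g = 1 - ε₀ ^ 2 := ⟨_, rfl⟩
  have hg0 : 0 < g := by rw [hg]; nlinarith
  have hg1 : g ≤ 1 := by rw [hg]; nlinarith
  set t : ℝ := Real.sqrt g / 2 with ht
  have ht0 : 0 < t := by have := Real.sqrt_pos.2 hg0; positivity
  have ht2 : t ^ 2 = g / 4 := by rw [ht, div_pow, Real.sq_sqrt hg0.le]; norm_num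
  have ht1 : t ≤ 1 := by nlinarith
  -- The bound 4/t is what `exists_unitary_family` requires. The bound 2/g lets half of g d² absorb
  -- the term of order d in the formula for `davg`.
  obtain ⟨n₁, hn₁⟩ := pow_unbounded_of_one_lt (max (4 / t) (2 / g)) (one_lt_two (α := ℝ))
  refine ⟨t ^ 3 / 32, by positivity, n₁, fun n hn => ?_⟩
  have hdn : (2 : ℝ) ^ n₁ ≤ 2 ^ n := pow_le_pow_right₀ one_le_two hn
  have hd1 : 4 ≤ t * (2 : ℝ) ^ n := by
    have : 4 / t ≤ 2 ^ n := (le_max_left _ _).trans (hn₁.le.trans hdn)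
    rwa [div_le_iff₀' ht0] at this
  have hd2 : 2 ≤ g * (2 : ℝ) ^ n := by
    have : 2 / g ≤ 2 ^ n := (le_max_right _ _).trans (hn₁.le.trans hdn)
    rwa [div_le_iff₀' hg0] at this
  obtain ⟨I, hI1, hI2, U, hU⟩ := exists_unitary_family ht0 ht1 (d := 2 ^ n)
    (by push_cast; exact hd1)
  push_cast at hU
  refine ⟨I, hI1, hI2, U, fun ε hε hε₀ V => ?_⟩
  let F : ℂ → Finset I := fun z => Finset.univ.filter fun p => t * 2 ^ n ≤
    ((z • (V : Matrix (Qubits n) (Qubits n) ℂ)).conjTranspose *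
      (U p : Matrix (Qubits n) (Qubits n) ℂ)).trace.re
  have hF : ∀ z : ℂ, ‖z‖ = 1 → ((F z).card : ℝ) ≤
      Real.exp (-(t ^ 3 / 32 * (2 ^ n) ^ 2)) * Fintype.card I :=
    fun z hz => hU ⟨_, smul_mem_unitaryGroup hz V⟩
  have hsub : (Finset.univ.filter fun p => davg V (U p) ≤ ε) ⊆
      (F 1 ∪ F (-1)) ∪ (F Complex.I ∪ F (-Complex.I)) := by
    intro p hp
    have h3 := norm_trace_sq_ge_of_davg_le (Finset.mem_filter.1 hp).2
    set T := ((V : Matrix (Qubits n) (Qubits n) ℂ).conjTranspose *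
      (U p : Matrix (Qubits n) (Qubits n) ℂ)).trace with hT
    have hε2 : ε ^ 2 ≤ 1 - g := by rw [hg]; nlinarith
    have h4 : 2 * (t * 2 ^ n) ^ 2 ≤ ‖T‖ ^ 2 := by
      refine le_trans ?_ h3
      rw [mul_pow, ht2]
      have e1 : ε ^ 2 * (2 ^ n * (2 ^ n + 1)) ≤ (1 - g) * ((2 : ℝ) ^ n * (2 ^ n + 1)) :=
        mul_le_mul_of_nonneg_right hε2 (by positivity)
      have hpos : (0 : ℝ) < 2 ^ n := by positivity
      nlinarith
    rw [← Complex.normSq_eq_norm_sq, Complex.normSq_apply] at h4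
    have htr : ∀ z : ℂ, ((z • (V : Matrix (Qubits n) (Qubits n) ℂ)).conjTranspose *
        (U p : Matrix (Qubits n) (Qubits n) ℂ)).trace = star z * T := by
      intro z
      rw [Matrix.conjTranspose_smul, Matrix.smul_mul, Matrix.trace_smul, smul_eq_mul]
    simp only [F, Finset.mem_union, Finset.mem_filter, Finset.mem_univ, true_and, htr]
    by_contra hcon
    push Not at hcon
    obtain ⟨⟨c1, c2⟩, c3, c4⟩ := hcon
    simp at c1 c2 c3 c4
    have hpos : (0 : ℝ) < t * 2 ^ n := by positivity
    have c5 : T.re ^ 2 < (t * 2 ^ n) ^ 2 := sq_lt_sq' (by linarith) c1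
    have c6 : T.im ^ 2 < (t * 2 ^ n) ^ 2 := sq_lt_sq' (by linarith) c3
    nlinarith
  have hcard : (Finset.univ.filter fun p => davg V (U p) ≤ ε).card ≤
      ((F 1).card + (F (-1)).card) + ((F Complex.I).card + (F (-Complex.I)).card) :=
    (Finset.card_le_card hsub).trans ((Finset.card_union_le _ _).trans
      (add_le_add (Finset.card_union_le _ _) (Finset.card_union_le _ _)))
  have hcard' : ((Finset.univ.filter fun p => davg V (U p) ≤ ε).card : ℝ) ≤
      ((F 1).card + (F (-1)).card) + ((F Complex.I).card + (F (-Complex.I)).card) := by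
    exact_mod_cast hcard
  have f1 := hF 1 (by simp)
  have f2 := hF (-1) (by simp)
  have f3 := hF Complex.I (by simp)
  have f4 := hF (-Complex.I) (by simp)
  linarith

lemma norm_inner_flatten_ge_of_davg_le {n : ℕ} {X V : Unitaries n} {ε : ℝ} (h : davg X V ≤ ε) :
    (2 ^ n : ℝ) * (1 - 2 * ε ^ 2) ≤
      ‖inner ℂ (flatten (X : Matrix (Qubits n) (Qubits n) ℂ))
        (flatten (V : Matrix (Qubits n) (Qubits n) ℂ))‖ := by
  have h1 := norm_trace_sq_ge_of_davg_le h
  have h2 := norm_trace_unitary_le X V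
  rw [inner_flatten]
  set T := ‖((X : Matrix (Qubits n) (Qubits n) ℂ).conjTranspose *
    (V : Matrix (Qubits n) (Qubits n) ℂ)).trace‖
  have hT0 : 0 ≤ T := norm_nonneg _
  simp only [Fintype.card_fin] at h2
  push_cast at h2
  have hd : (1 : ℝ) ≤ 2 ^ n := one_le_pow₀ one_le_two
  have h3 : T ^ 2 ≤ T * 2 ^ n := by rw [pow_two]; exact mul_le_mul_of_nonneg_left h2 hT0
  have h4 : ε ^ 2 * (2 ^ n * (2 ^ n + 1)) ≤ ε ^ 2 * ((2 : ℝ) ^ n * (2 * 2 ^ n)) := by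
    gcongr; linarith
  have h5 : (2 ^ n : ℝ) * (1 - 2 * ε ^ 2) * 2 ^ n ≤ T * 2 ^ n := by nlinarith
  exact le_of_mul_le_mul_right h5 (by positivity)

/-- All members close to a given unitary are close to one of them, U q. For U_p = a + i b H_p the
overlap of U q and U p is d - b² (d - 2R) with R = Re tr(V_q†V_p). Closeness makes it at least d (1
- 8ε²), and b = 4ε turns this into R ≥ d/4, half of the block dimension; the count for V q at t =
1/2 applies. The constant is t³/32 = 1/256, divided by 4 because the block dimension is d/2. -/
lemma hard_family_small {n : ℕ} (hn : 4 ≤ n) {ε : ℝ} (hε : 0 < ε) (hε1 : ε ≤ 1 / 8) :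
    ∃ (I : Type) (_ : Fintype I) (_ : Nonempty I) (U W : I → Unitaries n) (α β : ℂ),
      ‖β‖ ≤ 4 * ε ∧ (∀ p, (U p : Matrix (Qubits n) (Qubits n) ℂ) =
        α • 1 + β • (W p : Matrix (Qubits n) (Qubits n) ℂ)) ∧
      ∀ V : Unitaries n,
        ((Finset.univ.filter fun p => davg V (U p) ≤ ε).card : ℝ) ≤
          Real.exp (-(1 / 1024 * (2 ^ n) ^ 2)) * Fintype.card I := by
  obtain ⟨k, rfl⟩ : ∃ k, n = k + 1 := ⟨n - 1, by omega⟩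
  have hk8 : (8 : ℝ) ≤ 2 ^ k := by
    calc (8 : ℝ) = 2 ^ 3 := by norm_num
      _ ≤ 2 ^ k := pow_le_pow_right₀ one_le_two (by omega)
  obtain ⟨I, hI1, hI2, V, hV⟩ := exists_unitary_family (t := 1 / 2) (by norm_num) (by norm_num)
    (d := 2 ^ k) (by push_cast; linarith)
  let e : Qubits k ⊕ Qubits k ≃ Qubits (k + 1) :=
    finSumFinEquiv.trans (finCongr (by rw [pow_succ]; ring))
  set b : ℝ := 4 * ε with hb
  set a : ℝ := Real.sqrt (1 - b ^ 2) with ha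
  have hb2 : b ^ 2 ≤ 1 / 4 := by rw [hb]; nlinarith
  have ha2 : a ^ 2 = 1 - b ^ 2 := Real.sq_sqrt (by linarith)
  let H : I → Matrix (Qubits (k + 1)) (Qubits (k + 1)) ℂ := fun p =>
    blockHermitian e (V p : Matrix (Qubits k) (Qubits k) ℂ)
  have hHc : ∀ p, (H p).conjTranspose = H p := fun p => blockHermitian_conjTranspose e _
  have hHH : ∀ p, H p * H p = 1 := fun p => blockHermitian_mul_self e (V p)
  have hHu : ∀ p, H p ∈ Matrix.unitaryGroup (Qubits (k + 1)) ℂ := fun p => by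
    rw [Matrix.mem_unitaryGroup_iff', Matrix.star_eq_conjTranspose, hHc, hHH]
  let U : I → Unitaries (k + 1) := fun p =>
    ⟨_, affine_hermitian_mem_unitaryGroup (hHc p) (hHH p) (a := a) (b := b) (by linarith)⟩
  refine ⟨I, hI1, hI2, U, fun p => ⟨H p, hHu p⟩, a, b * Complex.I, ?_, fun p => rfl, fun X => ?_⟩
  · rw [norm_mul, Complex.norm_I, Complex.norm_real, Real.norm_of_nonneg (by positivity), mul_one]
  rcases Finset.eq_empty_or_nonempty (Finset.univ.filter fun p => davg X (U p) ≤ ε) with h | ⟨q, hq⟩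
  · rw [h]; simp; positivity
  have hclose : ∀ p, davg X (U p) ≤ ε → (2 ^ (k + 1) : ℝ) * (1 - 2 * ε ^ 2) ≤
      ‖inner ℂ (flatten (X : Matrix (Qubits (k + 1)) (Qubits (k + 1)) ℂ))
        (flatten (U p : Matrix (Qubits (k + 1)) (Qubits (k + 1)) ℂ))‖ :=
    fun p hp => norm_inner_flatten_ge_of_davg_le hp
  have hq' := hclose q (Finset.mem_filter.1 hq).2
  have hnorm : ∀ Z : Unitaries (k + 1),
      ‖flatten (Z : Matrix (Qubits (k + 1)) (Qubits (k + 1)) ℂ)‖ ^ 2 = 2 ^ (k + 1) := by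
    intro Z; rw [norm_flatten_sq]; simp
  refine le_trans (Nat.cast_le.2 (Finset.card_le_card (fun p hp => ?_))) ((hV (V q)).trans ?_)
  · have hp' := hclose p (Finset.mem_filter.1 hp).2
    have h1 := norm_inner_ge_of_norm_inner_ge (hnorm X) (hnorm (U q)) (hnorm (U p)) hq' hp'
    rw [inner_flatten] at h1
    have h2 := trace_affine_hermitian (K := H p) (hHc q) (trace_blockHermitian e _)
      (trace_blockHermitian e _) a b
    rw [trace_blockHermitian_mul] at h2
    change ((U q : Matrix (Qubits (k + 1)) (Qubits (k + 1)) ℂ).conjTranspose *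
      (U p : Matrix (Qubits (k + 1)) (Qubits (k + 1)) ℂ)).trace = _ at h2
    have h3 := norm_trace_unitary_le (V q) (V p)
    rw [Finset.mem_filter]
    refine ⟨Finset.mem_univ _, ?_⟩
    have h4 := (Complex.abs_re_le_norm _).trans h3
    set R := ((V q : Matrix (Qubits k) (Qubits k) ℂ).conjTranspose *
      (V p : Matrix (Qubits k) (Qubits k) ℂ)).trace.re
    simp only [Fintype.card_fin] at h4
    push_cast at h4
    have h5 : (a : ℂ) ^ 2 * Fintype.card (Qubits (k + 1)) + (b : ℂ) ^ 2 * ((2 * R : ℝ) : ℂ) =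
        ((a ^ 2 * 2 ^ (k + 1) + b ^ 2 * (2 * R) : ℝ) : ℂ) := by
      simp
    rw [h2, h5, Complex.norm_real, Real.norm_eq_abs, ha2, pow_succ] at h1
    have h6 := (abs_le.1 h4).1
    have hpos : (0 : ℝ) < 2 ^ k := by positivity
    rw [abs_of_nonneg (by nlinarith [sq_nonneg b])] at h1
    push_cast
    have hε2 : 0 < ε ^ 2 := by positivity
    have hbε : b ^ 2 = 16 * ε ^ 2 := by rw [hb]; ring
    rw [hbε] at h1
    nlinarith
  · refine mul_le_mul_of_nonneg_right (Real.exp_le_exp.2 ?_) (by positivity)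
    push_cast
    rw [pow_succ]
    ring_nf
    exact le_refl _

/-- A finite family of unitaries in a small ball such that every unitary is close to only an
exponentially small (in the square of the dimension) fraction of it. -/
lemma hard_family {ε₀ : ℝ} (h0 : 0 ≤ ε₀) (h1 : ε₀ < 1) :
    ∃ c : ℝ, 0 < c ∧ ∃ n₁ : ℕ, ∀ n, n₁ ≤ n → ∀ ε : ℝ, 0 < ε → ε ≤ ε₀ →
      ∃ (I : Type) (_ : Fintype I) (_ : Nonempty I) (U W : I → Unitaries n) (α β : ℂ),
      ‖β‖ ≤ 8 * ε ∧ (∀ p, (U p : Matrix (Qubits n) (Qubits n) ℂ) =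
        α • 1 + β • (W p : Matrix (Qubits n) (Qubits n) ℂ)) ∧
      ∀ V : Unitaries n,
        ((Finset.univ.filter fun p => davg V (U p) ≤ ε).card : ℝ) ≤
          4 * Real.exp (-(c * (2 ^ n) ^ 2)) * Fintype.card I := by
  obtain ⟨c, hc, n₁, hn₁⟩ := hard_family_large h0 h1
  refine ⟨min c (1 / 1024), by positivity, max n₁ 4, fun n hn ε hε hε₀ => ?_⟩
  have hexp : ∀ c' : ℝ, min c (1 / 1024) ≤ c' →
      Real.exp (-(c' * (2 ^ n) ^ 2)) ≤ Real.exp (-(min c (1 / 1024) * (2 ^ n) ^ 2)) := by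
    intro c' h
    refine Real.exp_le_exp.2 (neg_le_neg ?_)
    exact mul_le_mul_of_nonneg_right h (by positivity)
  rcases le_total ε (1 / 8) with h8 | h8
  · obtain ⟨I, hI1, hI2, U, W, α, β, hβ, hU, hV⟩ :=
      hard_family_small ((le_max_right _ _).trans hn) hε h8
    refine ⟨I, hI1, hI2, U, W, α, β, by linarith, hU, fun V => (hV V).trans ?_⟩
    refine mul_le_mul_of_nonneg_right ?_ (by positivity)
    refine (hexp _ (min_le_right _ _)).trans ?_
    linarith [Real.exp_pos (-(min c (1 / 1024) * (2 ^ n) ^ 2))]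
  · obtain ⟨I, hI1, hI2, U, hV⟩ := hn₁ n ((le_max_left _ _).trans hn)
    -- For ε ≥ 1/8 the radius 8ε is at least 1, so the affine form is no restriction.
    refine ⟨I, hI1, hI2, U, U, 0, 1, by rw [norm_one]; linarith, fun p => by simp,
      fun V => (hV ε hε.le hε₀ V).trans ?_⟩
    refine mul_le_mul_of_nonneg_right ?_ (by positivity)
    exact mul_le_mul_of_nonneg_left (hexp _ (min_le_left _ _)) (by norm_num)

end HardFamily

/-! ### Nets of small cardinality -/

section Quantization

open MeasureTheory Metric Module

/-- Volume comparison: the balls of radius δ/2 around the points are disjoint and lie in the ball of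
radius R + δ/2. -/
lemma card_le_of_separated {E : Type*} [NormedAddCommGroup E] [NormedSpace ℝ E]
    [FiniteDimensional ℝ E] (s : Finset E) {R δ : ℝ} (hR : 0 ≤ R) (hδ : 0 < δ)
    (hs : ∀ c ∈ s, ‖c‖ ≤ R) (h : ∀ c ∈ s, ∀ d ∈ s, c ≠ d → δ ≤ ‖c - d‖) :
    (s.card : ℝ) ≤ (1 + 2 * R / δ) ^ finrank ℝ E := by
  borelize E
  let μ : Measure E := Measure.addHaar
  have hδ2 : 0 < δ / 2 := by positivity
  have hρ : 0 < R + δ / 2 := by positivity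
  have hdisj : Set.Pairwise (s : Set E) (Function.onFun Disjoint fun c => ball (c : E) (δ / 2)) := by
    rintro c hc d hd hcd
    apply ball_disjoint_ball
    rw [dist_eq_norm, add_halves]
    exact h c hc d hd hcd
  have hsub : (⋃ c ∈ s, ball (c : E) (δ / 2)) ⊆ ball (0 : E) (R + δ / 2) := by
    refine Set.iUnion₂_subset fun x hx => ball_subset_ball' ?_
    rw [dist_zero_right, add_comm]
    exact add_le_add (hs x hx) le_rfl
  have h1 : (s.card : ENNReal) * ENNReal.ofReal ((δ / 2) ^ finrank ℝ E) * μ (ball 0 1) ≤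
      ENNReal.ofReal ((R + δ / 2) ^ finrank ℝ E) * μ (ball 0 1) := by
    calc _ = μ (⋃ c ∈ s, ball (c : E) (δ / 2)) := by
          rw [measure_biUnion_finset hdisj fun c _ => measurableSet_ball]
          simp only [μ.addHaar_ball_of_pos _ hδ2, Finset.sum_const, nsmul_eq_mul, mul_assoc]
      _ ≤ μ (ball (0 : E) (R + δ / 2)) := measure_mono hsub
      _ = _ := by rw [μ.addHaar_ball_of_pos _ hρ]
  have h2 : (s.card : ENNReal) * ENNReal.ofReal ((δ / 2) ^ finrank ℝ E) ≤
      ENNReal.ofReal ((R + δ / 2) ^ finrank ℝ E) :=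
    (ENNReal.mul_le_mul_iff_left (measure_ball_pos _ _ zero_lt_one).ne' measure_ball_lt_top.ne).1 h1
  have h3 := ENNReal.toReal_le_of_le_ofReal (pow_nonneg hρ.le _) h2
  rw [ENNReal.toReal_mul, ENNReal.toReal_natCast, ENNReal.toReal_ofReal (by positivity),
    ← le_div_iff₀ (by positivity), ← div_pow] at h3
  refine h3.trans_eq ?_
  congr 1
  field_simp
  ring

/-- Finitely many points in a ball are approximated by few of them. -/
lemma exists_net {I E : Type*} [Fintype I] [NormedAddCommGroup E] [NormedSpace ℂ E]
    [FiniteDimensional ℂ E] (G : I → E) {R δ : ℝ} (hR : 0 ≤ R) (hδ : 0 < δ)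
    (hG : ∀ p, ‖G p‖ ≤ R) :
    ∃ T : Finset I, (T.card : ℝ) ≤ (1 + 2 * R / δ) ^ (2 * finrank ℂ E) ∧
      ∀ p, ∃ q ∈ T, ‖G q - G p‖ ≤ δ := by
  classical
  let Sep : Finset I → Prop := fun T => ∀ p ∈ T, ∀ q ∈ T, p ≠ q → δ < ‖G p - G q‖
  -- A separated set of maximal cardinality is a net. Its points are members of the family, so the
  -- answers built from it are genuine output states.
  obtain ⟨T, hT, hmax⟩ := Finset.exists_max_image
    (Finset.univ.filter fun T : Finset I => Sep T) Finset.card ⟨∅, by simp [Sep]⟩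
  have hsep : Sep T := (Finset.mem_filter.1 hT).2
  refine ⟨T, ?_, fun p => ?_⟩
  · have hinj : Set.InjOn G T := by
      intro p hp q hq hpq
      by_contra hne
      have := hsep p hp q hq hne
      rw [hpq, sub_self, norm_zero] at this
      linarith
    rw [← Finset.card_image_of_injOn hinj, ← finrank_real_of_complex]
    refine card_le_of_separated _ hR hδ ?_ ?_
    · intro c hc
      obtain ⟨p, -, rfl⟩ := Finset.mem_image.1 hc
      exact hG p
    · intro c hc d hd hcd
      obtain ⟨p, hp, rfl⟩ := Finset.mem_image.1 hc
      obtain ⟨q, hq, rfl⟩ := Finset.mem_image.1 hd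
      exact (hsep p hp q hq fun h => hcd (by rw [h])).le
  · by_contra! hcon
    have hpT : p ∉ T := fun hp => by
      have := hcon p hp
      rw [sub_self, norm_zero] at this
      linarith
    have hins : Sep (insert p T) := by
      intro a ha b hb hab
      rcases Finset.mem_insert.1 ha with rfl | ha'
      · rcases Finset.mem_insert.1 hb with rfl | hb
        · exact absurd rfl hab
        · rw [norm_sub_rev]; exact hcon b hb
      · rcases Finset.mem_insert.1 hb with rfl | hb
        · exact hcon a ha'
        · exact hsep a ha' b hb hab
    have := hmax (insert p T) (by simp [hins])
    rw [Finset.card_insert_of_notMem hpT] at this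
    omega

end Quantization

/-! ### Counting transcripts -/

section Counting

open MeasureTheory

variable {n : ℕ} {X Y Ω I : Type}

/-- For fixed randomness the next input is a function of the transcript so far, so each transcript
has at most M continuations, even for adaptive learners. -/
lemma Learner.exists_finset_data (L : Learner n X Y Ω) (ω : Ω) (O : I → X → Y) {M : ℝ}
    (hM : ∀ x, ∃ T : Finset Y, (T.card : ℝ) ≤ M ∧ ∀ p, O p x ∈ T) (j : ℕ) :
    ∃ T : Finset (List (X × Y)), (T.card : ℝ) ≤ M ^ j ∧ ∀ p, L.data (O p) ω j ∈ T := by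
  classical
  induction j with
  | zero => exact ⟨{[]}, by simp, fun p => by simp [Learner.data]⟩
  | succ j ih =>
    obtain ⟨T, hT, hmem⟩ := ih
    choose A hA hmemA using hM
    refine ⟨T.biUnion fun D => (A (L.query ω D)).image fun y => D ++ [(L.query ω D, y)], ?_,
      fun p => ?_⟩
    · have h1 : ((T.biUnion fun D =>
          (A (L.query ω D)).image fun y => D ++ [(L.query ω D, y)]).card : ℝ) ≤
          ∑ D ∈ T, (((A (L.query ω D)).image fun y => D ++ [(L.query ω D, y)]).card : ℝ) := by
        exact_mod_cast Finset.card_biUnion_le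
      refine h1.trans ?_
      have h2 : ∀ D ∈ T, (((A (L.query ω D)).image fun y => D ++ [(L.query ω D, y)]).card : ℝ) ≤ M :=
        fun D _ => le_trans (by exact_mod_cast Finset.card_image_le) (hA _)
      refine (Finset.sum_le_card_nsmul _ _ _ h2).trans ?_
      rw [nsmul_eq_mul, pow_succ]
      rcases isEmpty_or_nonempty X with hX | ⟨⟨x⟩⟩
      · exact isEmptyElim (L.query ω [])
      · exact mul_le_mul_of_nonneg_right hT ((Nat.cast_nonneg _).trans (hA x))
    · refine Finset.mem_biUnion.2 ⟨_, hmem p, Finset.mem_image.2 ⟨_, hmemA _ p, rfl⟩⟩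

variable [Fintype I]

/-- A learner that receives few different answers cannot distinguish many unitaries. -/
lemma Learner.Learns.card_le [MeasurableSpace Ω] {P : Measure Ω} [IsProbabilityMeasure P]
    {L : Learner n X Y Ω} {N : ℕ} {ε : ℝ} {Valid : Unitaries n → X → Y → Prop}
    (hL : L.Learns P N ε Valid) (U : I → Unitaries n) (O : I → X → Y)
    (hO : ∀ p x, Valid (U p) x (O p x)) {M B : ℝ} (hB0 : 0 ≤ B)
    (hM : ∀ x, ∃ T : Finset Y, (T.card : ℝ) ≤ M ∧ ∀ p, O p x ∈ T)
    (hB : ∀ V : Unitaries n, ((Finset.univ.filter fun p => davg V (U p) ≤ ε).card : ℝ) ≤ B) :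
    2 / 3 * (Fintype.card I : ℝ) ≤ M ^ N * B := by
  classical
  choose E hEm hEP hE using fun p => hL (U p) (O p) (hO p)
  -- For fixed ω each transcript yields one hypothesis, which is correct for at most B members.
  -- Integrating over ω compares this with the success probability 2/3 of each member.
  have hcount : ∀ ω, ((Finset.univ.filter fun p => ω ∈ E p).card : ℝ) ≤ M ^ N * B := by
    intro ω
    obtain ⟨T, hT, hmem⟩ := L.exists_finset_data ω O hM N
    have hsub : (Finset.univ.filter fun p => ω ∈ E p) ⊆
        T.biUnion fun D => Finset.univ.filter fun p => davg (L.guess ω D) (U p) ≤ ε := by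
      intro p hp
      refine Finset.mem_biUnion.2 ⟨_, hmem p, ?_⟩
      exact Finset.mem_filter.2 ⟨Finset.mem_univ _, hE p ω (Finset.mem_filter.1 hp).2⟩
    have h1 : ((Finset.univ.filter fun p => ω ∈ E p).card : ℝ) ≤
        ∑ D ∈ T, ((Finset.univ.filter fun p => davg (L.guess ω D) (U p) ≤ ε).card : ℝ) := by
      exact_mod_cast (Finset.card_le_card hsub).trans Finset.card_biUnion_le
    refine h1.trans ((Finset.sum_le_card_nsmul _ _ _ fun D _ => hB _).trans ?_)
    rw [nsmul_eq_mul]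
    exact mul_le_mul_of_nonneg_right hT hB0
  have hint : ∑ p, P (E p) ≤ ENNReal.ofReal (M ^ N * B) := by
    calc ∑ p, P (E p) = ∫⁻ ω, ∑ p, (E p).indicator 1 ω ∂P := by
          rw [lintegral_finsetSum _ fun p _ => measurable_one.indicator (hEm p)]
          exact Finset.sum_congr rfl fun p _ => (lintegral_indicator_one (hEm p)).symm
      _ ≤ ∫⁻ _, ENNReal.ofReal (M ^ N * B) ∂P := by
          refine lintegral_mono fun ω => ?_
          have : ∑ p, (E p).indicator (1 : Ω → ENNReal) ω =
              ((Finset.univ.filter fun p => ω ∈ E p).card : ENNReal) := by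
            simp [Set.indicator_apply]
          rw [this, ← ENNReal.ofReal_natCast]
          exact ENNReal.ofReal_le_ofReal (hcount ω)
      _ = _ := by simp
  have hlow : (Fintype.card I : ENNReal) * (2 / 3) ≤ ∑ p, P (E p) := by
    rw [← nsmul_eq_mul]
    exact Finset.card_nsmul_le_sum _ _ _ fun p _ => hEP p
  have h := hlow.trans hint
  have hne : Nonempty Ω := P.nonempty_of_neZero
  have hMB : 0 ≤ M ^ N * B := (Nat.cast_nonneg _).trans (hcount hne.some)
  have h2 := ENNReal.toReal_mono ENNReal.ofReal_ne_top h
  rw [ENNReal.toReal_ofReal hMB, ENNReal.toReal_mul] at h2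
  simp at h2
  linarith

end Counting

/-! ### From quantized sources to lower bounds -/

section LowerBoundReduction

open MeasureTheory

variable {n : ℕ} {X Y Ω : Type}

/-- For every finite family `α + β W p` of unitaries there is a source of noisy data that on each
input distinguishes only few of them. -/
def Quantizable (Valid : Unitaries n → X → Y → Prop) (D : ℕ) (η : ℝ) : Prop :=
  ∀ (I : Type) [Fintype I] (U W : I → Unitaries n) (α β : ℂ) (R δ : ℝ), ‖β‖ ≤ R → 0 < δ → δ ≤ η →
    (∀ p, (U p : Matrix (Qubits n) (Qubits n) ℂ) =
      α • 1 + β • (W p : Matrix (Qubits n) (Qubits n) ℂ)) →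
    ∃ O : I → X → Y, (∀ p x, Valid (U p) x (O p x)) ∧
      ∀ x, ∃ T : Finset Y, (T.card : ℝ) ≤ (1 + 2 * R / δ) ^ D ∧ ∀ p, O p x ∈ T

/-- Without data a learner would have to serve both 1 and a traceless unitary with one hypothesis.
For ε ≤ 1/3 no hypothesis is close to both, as that would give their overlap the lower bound d (1 -
8ε²) > 0; but success on both needs 2 · 2/3 ≤ 1. -/
lemma Learner.Learns.queries_ne_zero [MeasurableSpace Ω] {P : Measure Ω} [IsProbabilityMeasure P]
    {L : Learner n X Y Ω} {N D : ℕ} {ε η : ℝ} {Valid : Unitaries n → X → Y → Prop}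
    (hL : L.Learns P N ε Valid) (hQ : Quantizable Valid D η) (hη : 0 < η) (hn : 1 ≤ n)
    (hε0 : 0 < ε) (hε : ε ≤ 1 / 3) : N ≠ 0 := by
  rintro rfl
  obtain ⟨k, rfl⟩ : ∃ k, n = k + 1 := ⟨n - 1, by omega⟩
  let e : Qubits k ⊕ Qubits k ≃ Qubits (k + 1) :=
    finSumFinEquiv.trans (finCongr (by rw [pow_succ]; ring))
  let Z : Unitaries (k + 1) := ⟨blockHermitian e 1, by
    rw [Matrix.mem_unitaryGroup_iff', Matrix.star_eq_conjTranspose, blockHermitian_conjTranspose]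
    exact blockHermitian_mul_self e 1⟩
  let U : Bool → Unitaries (k + 1) := fun b => if b then 1 else Z
  obtain ⟨O, hO, hT⟩ := hQ Bool U U 0 1 1 η (by simp) hη le_rfl (by simp)
  have h := hL.card_le U O hO zero_le_one hT (fun V => by
    by_contra! hcon
    have hcard : 1 < (Finset.univ.filter fun p => davg V (U p) ≤ ε).card := by exact_mod_cast hcon
    have hall : ∀ p, davg V (U p) ≤ ε := by
      obtain ⟨p, hp, q, hq, hpq⟩ := Finset.one_lt_card.1 hcard
      have hp := (Finset.mem_filter.1 hp).2
      have hq := (Finset.mem_filter.1 hq).2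
      cases p <;> cases q <;> simp_all
    have hnorm : ∀ Z : Unitaries (k + 1),
        ‖flatten (Z : Matrix (Qubits (k + 1)) (Qubits (k + 1)) ℂ)‖ ^ 2 = 2 ^ (k + 1) := by
      intro Z; rw [norm_flatten_sq]; simp
    have h1 := norm_inner_ge_of_norm_inner_ge (hnorm V) (hnorm 1) (hnorm Z)
      (norm_inner_flatten_ge_of_davg_le (hall true)) (norm_inner_flatten_ge_of_davg_le (hall false))
    rw [inner_flatten] at h1
    have h2 : ((1 : Unitaries (k + 1)) : Matrix (Qubits (k + 1)) (Qubits (k + 1)) ℂ).conjTranspose *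
        (Z : Matrix (Qubits (k + 1)) (Qubits (k + 1)) ℂ) = blockHermitian e 1 := by
      simp [Z]
    rw [h2, trace_blockHermitian, norm_zero] at h1
    have h3 : (0 : ℝ) < 2 ^ (k + 1) := by positivity
    have h4 : 0 < 1 - 4 * (2 * ε ^ 2) := by nlinarith
    exact absurd (mul_pos h3 h4) (not_lt.2 h1))
  norm_num at h

/-- The lower bound on the number of queries in terms of the size `D` of the data. -/
lemma Learner.Learns.sq_dim_le [MeasurableSpace Ω] {P : Measure Ω} [IsProbabilityMeasure P]
    {L : Learner n X Y Ω} {N D : ℕ} {ε η κ c : ℝ} {Valid : Unitaries n → X → Y → Prop}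
    (hL : L.Learns P N ε Valid) (hQ : Quantizable Valid D η) (hκ : 0 < κ) (hε0 : 0 < ε)
    (hη : κ * ε ≤ η)
    (hF : ∃ (I : Type) (_ : Fintype I) (_ : Nonempty I) (U W : I → Unitaries n) (α β : ℂ),
      ‖β‖ ≤ 8 * ε ∧ (∀ p, (U p : Matrix (Qubits n) (Qubits n) ℂ) =
        α • 1 + β • (W p : Matrix (Qubits n) (Qubits n) ℂ)) ∧
      ∀ V : Unitaries n,
        ((Finset.univ.filter fun p => davg V (U p) ≤ ε).card : ℝ) ≤
          4 * Real.exp (-(c * (2 ^ n) ^ 2)) * Fintype.card I) :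
    c * (2 ^ n) ^ 2 ≤ 5 + D * N * Real.log (1 + 16 / κ) := by
  obtain ⟨I, hI1, hI2, U, W, α, β, hβ, hU, hV⟩ := hF
  -- Net scale and radius are both proportional to ε, so the number of answers does not depend on ε.
  obtain ⟨O, hO, hT⟩ := hQ I U W α β (8 * ε) (κ * ε) hβ (by positivity) hη hU
  have h := hL.card_le U O hO (by positivity) hT hV
  have hC : 1 + 2 * (8 * ε) / (κ * ε) = 1 + 16 / κ := by field_simp; norm_num
  rw [hC] at h
  set C : ℝ := 1 + 16 / κ with hCdef
  have hC0 : 0 < C := by positivity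
  have hcard : (0 : ℝ) < Fintype.card I := by exact_mod_cast Fintype.card_pos
  have h2 : 2 / 3 ≤ (C ^ D) ^ N * (4 * Real.exp (-(c * (2 ^ n) ^ 2))) := by
    rw [← mul_assoc] at h
    exact le_of_mul_le_mul_right h hcard
  have h3 : (C ^ D) ^ N = Real.exp (D * N * Real.log C) := by
    rw [← pow_mul, ← Real.exp_log (pow_pos hC0 _), Real.log_pow]; push_cast; rfl
  rw [h3] at h2
  have h4 : Real.exp (c * (2 ^ n) ^ 2) ≤ 6 * Real.exp (D * N * Real.log C) := by
    rw [Real.exp_neg] at h2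
    have hpos := Real.exp_pos (c * (2 ^ n) ^ 2)
    have h5 := mul_le_mul_of_nonneg_right h2 hpos.le
    have h6 : Real.exp (D * N * Real.log C) * (4 * (Real.exp (c * (2 ^ n) ^ 2))⁻¹) *
        Real.exp (c * (2 ^ n) ^ 2) = 4 * Real.exp (D * N * Real.log C) := by
      field_simp
    rw [h6] at h5
    linarith
  have h7 : Real.exp (c * (2 ^ n) ^ 2) ≤ Real.exp (5 + D * N * Real.log C) := by
    rw [Real.exp_add]
    refine h4.trans (mul_le_mul_of_nonneg_right ?_ (Real.exp_pos _).le)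
    linarith [Real.add_one_le_exp (5 : ℝ)]
  exact Real.exp_le_exp.1 h7

end LowerBoundReduction

/-! ### Noisy sources with few answers -/

section NoisySources

variable {n r : ℕ}

/-- The product ket `|a⟩ ⊗ |b⟩`. -/
def tensorKet (a b : Vec (Qubits n)) : Vec (TwoQubits n) :=
  WithLp.toLp 2 fun q => a q.1 * b q.2

lemma ketbra_kronecker_ketbra (a b : Vec (Qubits n)) :
    ketbra a ⊗ₖ ketbra b = ketbra (tensorKet a b) := by
  ext ⟨i, j⟩ ⟨k, l⟩
  simp [ketbra, tensorKet, Matrix.vecMulVec_apply]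
  ring

lemma norm_tensorKet (a b : Vec (Qubits n)) : ‖tensorKet a b‖ = ‖a‖ * ‖b‖ := by
  have h : ‖tensorKet a b‖ ^ 2 = (‖a‖ * ‖b‖) ^ 2 := by
    rw [mul_pow, EuclideanSpace.norm_sq_eq, EuclideanSpace.norm_sq_eq, EuclideanSpace.norm_sq_eq,
      Finset.sum_mul_sum, Fintype.sum_prod_type]
    simp [tensorKet, mul_pow]
  exact (sq_eq_sq₀ (norm_nonneg _) (by positivity)).1 h

lemma tensorKet_sub (a a' b : Vec (Qubits n)) :
    tensorKet a b - tensorKet a' b = tensorKet (a - a') b := by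
  ext q; simp [tensorKet]; ring

lemma applyDensity_product (U : Unitaries n) (a b : Vec (Qubits n)) :
    applyDensity U (ketbra a ⊗ₖ ketbra b) =
      ketbra (tensorKet (Matrix.toEuclideanLin (U : Matrix (Qubits n) (Qubits n) ℂ) a) b) := by
  rw [← ketbra_kronecker_ketbra, applyDensity, localOp, Matrix.conjTranspose_kronecker,
    ← Matrix.mul_kronecker_mul, ← Matrix.mul_kronecker_mul, Matrix.conjTranspose_one, one_mul,
    mul_one]
  congr 1
  rw [ketbra, ketbra, Matrix.mul_vecMulVec, Matrix.vecMulVec_mul, Matrix.toLpLin_apply,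
    Matrix.star_mulVec]

lemma applyDensity_sum (U : Unitaries n) (p : Fin r → ℝ) (φ ψ : Fin r → Vec (Qubits n)) :
    applyDensity U (∑ j, (p j : ℂ) • (ketbra (φ j) ⊗ₖ ketbra (ψ j))) =
      ∑ j, (p j : ℂ) • ketbra (tensorKet
        (Matrix.toEuclideanLin (U : Matrix (Qubits n) (Qubits n) ℂ) (φ j)) (ψ j)) := by
  simp_rw [← applyDensity_product]
  simp only [applyDensity, Finset.mul_sum, Finset.sum_mul, Matrix.mul_smul, Matrix.smul_mul]

lemma isDensity_applyDensity (U : Unitaries n) {ρ : Matrix (TwoQubits n) (TwoQubits n) ℂ}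
    (hρ : IsMixedInput r ρ) : IsDensity (applyDensity U ρ) := by
  obtain ⟨p, φ, ψ, hp, hsum, hφ, hψ, rfl⟩ := hρ
  rw [applyDensity_sum]
  refine ⟨Matrix.posSemidef_sum _ fun j _ => ?_, ?_⟩
  · refine Matrix.PosSemidef.smul ?_ (by exact_mod_cast hp j)
    exact Matrix.posSemidef_vecMulVec_self_star _
  · rw [Matrix.trace_sum]
    have : ∀ j, ((p j : ℂ) • ketbra (tensorKet
        (Matrix.toEuclideanLin (U : Matrix (Qubits n) (Qubits n) ℂ) (φ j)) (ψ j))).trace = p j := by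
      intro j
      rw [Matrix.trace_smul, trace_ketbra, smul_eq_mul, mul_one]
      rw [norm_tensorKet, norm_toEuclideanLin_unitary, hφ, hψ, mul_one]
    simp_rw [this]
    exact_mod_cast hsum

/-- Each difference is |a⟩⟨a| - |b⟩⟨b| = |a⟩⟨a-b| + |a-b⟩⟨b|, two rank-one terms of trace norm at
most δ. The factor 1/2 in the trace distance cancels the 2. -/
lemma traceDist_mixture_ketbra_le {ι : Type} [Fintype ι] [DecidableEq ι] {p : Fin r → ℝ}
    (hp : ∀ j, 0 ≤ p j) (hsum : ∑ j, p j = 1) {a b : Fin r → Vec ι} (ha : ∀ j, ‖a j‖ = 1)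
    (hb : ∀ j, ‖b j‖ = 1) {δ : ℝ} (hab : ∀ j, ‖a j - b j‖ ≤ δ) :
    traceDist (∑ j, (p j : ℂ) • ketbra (a j)) (∑ j, (p j : ℂ) • ketbra (b j)) ≤ δ := by
  have h1 : ∑ j, (p j : ℂ) • ketbra (a j) - ∑ j, (p j : ℂ) • ketbra (b j) =
      ∑ q : Fin r ⊕ Fin r, ((Sum.elim p p q : ℝ) : ℂ) • Matrix.vecMulVec
        (Sum.elim a (fun j => a j - b j) q).ofLp
        (star (Sum.elim (fun j => a j - b j) b q).ofLp) := by
    rw [Fintype.sum_sum_type, ← Finset.sum_sub_distrib, ← Finset.sum_add_distrib]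
    refine Finset.sum_congr rfl fun j _ => ?_
    simp only [Sum.elim_inl, Sum.elim_inr]
    rw [← smul_sub, ← smul_add]
    congr 1
    ext i k
    simp [ketbra, Matrix.vecMulVec_apply]
    ring
  rw [traceDist, h1]
  have h2 := traceNorm_sum_vecMulVec_le (Sum.elim p p) (Sum.elim a fun j => a j - b j)
    (Sum.elim (fun j => a j - b j) b)
  have h3 : ∑ q : Fin r ⊕ Fin r, |Sum.elim p p q| *
      (‖Sum.elim a (fun j => a j - b j) q‖ * ‖Sum.elim (fun j => a j - b j) b q‖) ≤ 2 * δ := by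
    rw [Fintype.sum_sum_type, ← Finset.sum_add_distrib]
    calc _ ≤ ∑ j, p j * (2 * δ) := by
          refine Finset.sum_le_sum fun j _ => ?_
          simp only [Sum.elim_inl, Sum.elim_inr, ha, hb, abs_of_nonneg (hp j)]
          nlinarith [hp j, hab j]
      _ = 2 * δ := by rw [← Finset.sum_mul, hsum, one_mul]
  linarith

lemma toEuclideanLin_affine {ι : Type} [Fintype ι] [DecidableEq ι] {U W : Matrix ι ι ℂ} {α β : ℂ}
    (h : U = α • 1 + β • W) (x : Vec ι) :
    Matrix.toEuclideanLin U x = α • x + β • Matrix.toEuclideanLin W x := by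
  rw [h]
  ext i
  simp [Matrix.toLpLin_apply]

/-- Once the weights and flags of ρ are fixed, the output depends only on the r vectors U φ_j, in a
space of complex dimension d r. The net lives there, in the maximum norm over j, and the common part
α φ_j drops out of differences. -/
lemma quantizable_mixedNoisy {η : ℝ} :
    Quantizable (MixedNoisy (n := n) (r := r) η) (2 * (2 ^ n * r)) η := by
  classical
  intro I _ U W α β R δ hβ hδ hδη hU
  have hR : 0 ≤ R := (norm_nonneg _).trans hβ
  have key : ∀ ρ : MixedInput n r, ∃ T : Finset I,
      (T.card : ℝ) ≤ (1 + 2 * R / δ) ^ (2 * (2 ^ n * r)) ∧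
      ∀ p, ∃ q ∈ T, traceDist (applyDensity (U q) ρ.1) (applyDensity (U p) ρ.1) ≤ δ := by
    rintro ⟨ρ, w, φ, ψ, hw, hsum, hφ, hψ, rfl⟩
    let G : I → (Fin r → Vec (Qubits n)) := fun p j =>
      β • Matrix.toEuclideanLin (W p : Matrix (Qubits n) (Qubits n) ℂ) (φ j)
    have hG : ∀ p, ‖G p‖ ≤ R := by
      intro p
      refine (pi_norm_le_iff_of_nonneg hR).2 fun j => ?_
      rw [norm_smul, norm_toEuclideanLin_unitary, hφ, mul_one]
      exact hβ
    obtain ⟨T, hT, hnet⟩ := exists_net G hR hδ hG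
    have hfin : Module.finrank ℂ (Fin r → Vec (Qubits n)) = 2 ^ n * r := by
      rw [Module.finrank_pi_fintype]; simp [mul_comm]
    rw [hfin] at hT
    refine ⟨T, hT, fun p => ?_⟩
    obtain ⟨q, hq, hqp⟩ := hnet p
    refine ⟨q, hq, ?_⟩
    rw [applyDensity_sum, applyDensity_sum]
    have hunit : ∀ (p : I) j, ‖tensorKet (Matrix.toEuclideanLin
        (U p : Matrix (Qubits n) (Qubits n) ℂ) (φ j)) (ψ j)‖ = 1 := by
      intro p j
      rw [norm_tensorKet, norm_toEuclideanLin_unitary, hφ, hψ, mul_one]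
    refine traceDist_mixture_ketbra_le hw hsum (hunit q) (hunit p) fun j => ?_
    rw [tensorKet_sub, norm_tensorKet, hψ, mul_one, toEuclideanLin_affine (hU q),
      toEuclideanLin_affine (hU p), add_sub_add_left_eq_sub]
    exact (norm_le_pi_norm (G q - G p) j).trans hqp
  choose T hT f hfT hf using key
  refine ⟨fun p ρ => ⟨applyDensity (U (f ρ p)) ρ.1, isDensity_applyDensity _ ρ.2⟩,
    fun p ρ => (hf ρ p).trans hδη, fun ρ => ⟨(T ρ).image fun q =>
      ⟨applyDensity (U q) ρ.1, isDensity_applyDensity _ ρ.2⟩, ?_, fun p => ?_⟩⟩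
  · exact le_trans (by exact_mod_cast Finset.card_image_le) (hT ρ)
  · exact Finset.mem_image.2 ⟨_, hfT ρ p, rfl⟩

lemma localOp_mem (U : Unitaries n) : localOp U ∈ Matrix.unitaryGroup (TwoQubits n) ℂ := by
  rw [Matrix.mem_unitaryGroup_iff', localOp, Matrix.star_eq_conjTranspose,
    Matrix.conjTranspose_kronecker, ← Matrix.mul_kronecker_mul, ← Matrix.star_eq_conjTranspose,
    Unitary.star_mul_self_of_mem U.2, Matrix.conjTranspose_one, one_mul, Matrix.one_kronecker_one]

lemma norm_applyKet (U : Unitaries n) (x : Vec (TwoQubits n)) : ‖applyKet U x‖ = ‖x‖ :=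
  norm_toEuclideanLin_unitary ⟨localOp U, localOp_mem U⟩ x

lemma applyKet_apply (U : Unitaries n) (x : Vec (TwoQubits n)) (i j : Qubits n) :
    applyKet U x (i, j) = ∑ k, (U : Matrix (Qubits n) (Qubits n) ℂ) i k * x (k, j) := by
  simp [applyKet, localOp, Matrix.toLpLin_apply, Matrix.mulVec, dotProduct, Fintype.sum_prod_type,
    Matrix.one_apply]

/-- In matrix form U ⊗ I is multiplication by U from the left, so each of the d rows stays in the
row space, whose dimension is the Schmidt rank. -/
lemma exists_submodule_applyKet (x : Vec (TwoQubits n)) :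
    ∃ S : Submodule ℂ (Vec (TwoQubits n)), Module.finrank ℂ S ≤ 2 ^ n * schmidtRank x ∧
      ∀ U : Unitaries n, applyKet U x ∈ S := by
  set A : Matrix (Qubits n) (Qubits n) ℂ := Matrix.of fun i j => x (i, j) with hA
  let K := Submodule.span ℂ (Set.range A.row)
  let Ψ : (Qubits n → K) →ₗ[ℂ] Vec (TwoQubits n) :=
    { toFun := fun f => WithLp.toLp 2 fun q => (f q.1 : Qubits n → ℂ) q.2
      map_add' := fun f g => by ext q; simp
      map_smul' := fun c f => by ext q; simp }
  refine ⟨LinearMap.range Ψ, ?_, fun U => ?_⟩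
  · refine (LinearMap.finrank_range_le Ψ).trans ?_
    change _ ≤ 2 ^ n * A.rank
    rw [Module.finrank_pi_fintype, Matrix.rank_eq_finrank_span_row]
    simp [K]
  · refine ⟨fun i => ∑ k, (U : Matrix (Qubits n) (Qubits n) ℂ) i k •
      ⟨A.row k, Submodule.subset_span ⟨k, rfl⟩⟩, ?_⟩
    ext ⟨i, j⟩
    rw [applyKet_apply]
    simp [Ψ, hA, Finset.sum_apply]

lemma applyKet_affine {U W : Unitaries n} {α β : ℂ}
    (h : (U : Matrix (Qubits n) (Qubits n) ℂ) =
      α • 1 + β • (W : Matrix (Qubits n) (Qubits n) ℂ)) (x : Vec (TwoQubits n)) :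
    applyKet U x = α • x + β • applyKet W x := by
  refine toEuclideanLin_affine ?_ x
  rw [localOp, h, Matrix.add_kronecker, Matrix.smul_kronecker, Matrix.smul_kronecker,
    Matrix.one_kronecker_one, localOp]

lemma quantizable_entangledNoisy {η : ℝ} :
    Quantizable (EntangledNoisy (n := n) (r := r) η) (2 * (2 ^ n * r)) η := by
  classical
  intro I _ U W α β R δ hβ hδ hδη hU
  have hR : 0 ≤ R := (norm_nonneg _).trans hβ
  have hunit : ∀ (x : EntangledInput n r) (p : I), ‖applyKet (U p) x.1‖ = 1 := fun x p =>
    (norm_applyKet _ _).trans x.2.1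
  have key : ∀ x : EntangledInput n r, ∃ T : Finset I,
      (T.card : ℝ) ≤ (1 + 2 * R / δ) ^ (2 * (2 ^ n * r)) ∧
      ∀ p, ∃ q ∈ T, ketDist (applyKet (U q) x.1) (applyKet (U p) x.1) ≤ δ := by
    intro x
    obtain ⟨S, hS, hmem⟩ := exists_submodule_applyKet x.1
    let G : I → S := fun p => β • ⟨applyKet (W p) x.1, hmem (W p)⟩
    have hG : ∀ p, ‖G p‖ ≤ R := by
      intro p
      have h1 : ‖(⟨applyKet (W p) x.1, hmem (W p)⟩ : S)‖ = 1 := by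
        rw [Submodule.coe_norm, norm_applyKet, x.2.1]
      rw [norm_smul, h1, mul_one]
      exact hβ
    obtain ⟨T, hT, hnet⟩ := exists_net G hR hδ hG
    refine ⟨T, hT.trans (pow_le_pow_right₀ ?_ ?_), fun p => ?_⟩
    · have : 0 ≤ 2 * R / δ := by positivity
      linarith
    · exact Nat.mul_le_mul_left 2 (hS.trans (Nat.mul_le_mul_left _ x.2.2))
    obtain ⟨q, hq, hqp⟩ := hnet p
    refine ⟨q, hq, (ketDist_le_norm_sub (hunit x q) (hunit x p)).trans ?_⟩
    rw [applyKet_affine (hU q), applyKet_affine (hU p), add_sub_add_left_eq_sub]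
    exact hqp
  choose T hT f hfT hf using key
  refine ⟨fun p x => ⟨applyKet (U (f x p)) x.1, hunit x _⟩,
    fun p x => (hf x p).trans hδη, fun x => ⟨(T x).image fun q =>
      ⟨applyKet (U q) x.1, hunit x q⟩, ?_, fun p => ?_⟩⟩
  · exact le_trans (by exact_mod_cast Finset.card_image_le) (hT x)
  · exact Finset.mem_image.2 ⟨_, hfT x p, rfl⟩

end NoisySources

/-! ### Assembling the lower bound -/

section LowerBound

open MeasureTheory

/-- The lower bound for all models of noisy data of dimension `2 ^ n * r`. -/
lemma queries_lower_bound {ε₀ : ℝ} (hε₀ : ε₀ < 1) : ∃ n₀ : ℕ, (ε₀ ≤ 1 / 3 → n₀ ≤ 1) ∧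
    ∀ κ : ℝ, 0 < κ → ∃ c : ℝ, 0 < c ∧
      ∀ n r N : ℕ, n₀ ≤ n → 1 ≤ r → ∀ ε η : ℝ, 0 < ε → ε ≤ ε₀ → κ * ε ≤ η →
        ∀ (Ω : Type) [MeasurableSpace Ω] (P : Measure Ω) [IsProbabilityMeasure P] (X Y : Type)
          (Valid : Unitaries n → X → Y → Prop), Quantizable Valid (2 * (2 ^ n * r)) η →
          ∀ L : Learner n X Y Ω, L.Learns P N ε Valid → c * (2 ^ n / r) ≤ N := by
  obtain ⟨c, hc, n₁, hF⟩ := hard_family (le_max_right ε₀ 0) (max_lt hε₀ one_pos)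
  -- With c d ≥ 10 the additive constant 5 is at most half of c d².
  obtain ⟨n₂, hn₂⟩ := pow_unbounded_of_one_lt (10 / c) (one_lt_two (α := ℝ))
  set n₃ := max n₁ n₂
  refine ⟨if ε₀ ≤ 1 / 3 then 1 else n₃, fun h => by rw [if_pos h], fun κ hκ => ?_⟩
  set l := Real.log (1 + 16 / κ) with hl
  have hl0 : 0 < l := Real.log_pos (by have : 0 < 16 / κ := by positivity
                                       linarith)
  -- The first value serves n ≥ n₃. The second makes the claimed bound at most 1 for n < n₃, where N
  -- ≠ 0 is enough; this range occurs only for ε₀ ≤ 1/3.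
  refine ⟨min (c / (4 * l)) (1 / 2 ^ n₃), by positivity, ?_⟩
  intro n r N hn hr ε η hε hεε₀ hη Ω _ P _ X Y Valid hQ L hL
  have hr0 : (1 : ℝ) ≤ r := by exact_mod_cast hr
  have hd : (1 : ℝ) ≤ 2 ^ n := one_le_pow₀ one_le_two
  rcases le_or_gt n₃ n with h3 | h3
  · have h := hL.sq_dim_le hQ hκ hε hη (hF n ((le_max_left _ _).trans h3) ε hε
      (hεε₀.trans (le_max_left _ _)))
    push_cast at h
    have hcd : 10 ≤ c * 2 ^ n := by
      have h4 : 10 / c ≤ 2 ^ n :=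
        hn₂.le.trans (pow_le_pow_right₀ one_le_two ((le_max_right _ _).trans h3))
      rwa [div_le_iff₀' hc] at h4
    have h5 : c * 2 ^ n ≤ 4 * l * (r * N) := by
      have h6 : 10 ≤ c * (2 ^ n) ^ 2 := by nlinarith
      have h7 : c * 2 ^ n * 2 ^ n ≤ 4 * l * (r * N) * 2 ^ n := by nlinarith
      exact le_of_mul_le_mul_right h7 (by positivity)
    calc min (c / (4 * l)) (1 / 2 ^ n₃) * (2 ^ n / r) ≤ c / (4 * l) * (2 ^ n / r) :=
          mul_le_mul_of_nonneg_right (min_le_left _ _) (by positivity)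
      _ = c * 2 ^ n / (4 * l * r) := by field_simp
      _ ≤ N := by
          rw [div_le_iff₀ (by positivity)]
          linarith
  · have hsmall : ε₀ ≤ 1 / 3 := by
      by_contra h
      rw [if_neg h] at hn
      omega
    rw [if_pos hsmall] at hn
    have hN := hL.queries_ne_zero hQ (lt_of_lt_of_le (by positivity) hη) hn hε
      (hεε₀.trans hsmall)
    have hN1 : (1 : ℝ) ≤ N := by exact_mod_cast Nat.one_le_iff_ne_zero.2 hN
    refine le_trans ?_ hN1
    calc min (c / (4 * l)) (1 / 2 ^ n₃) * (2 ^ n / r) ≤ 1 / 2 ^ n₃ * (2 ^ n / 1) := by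
          refine mul_le_mul (min_le_right _ _) ?_ (by positivity) (by positivity)
          exact div_le_div_of_nonneg_left (by positivity) one_pos hr0
      _ = 2 ^ n / 2 ^ n₃ := by ring
      _ ≤ 1 := by
          rw [div_le_one (by positivity)]
          exact pow_le_pow_right₀ one_le_two h3.le

end LowerBound

/-! ### Learning from anchor states -/

section UpperBound

variable {n r : ℕ}

lemma davg_eq_zero_of_eqUpToPhase {U V : Unitaries n} (h : EqUpToPhase U V) : davg U V = 0 := by
  obtain ⟨z, hz, hU⟩ := h
  have h1 := davg_sq U V
  rw [hU, Matrix.conjTranspose_smul, Matrix.smul_mul, ← Matrix.star_eq_conjTranspose,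
    Unitary.star_mul_self_of_mem V.2, Matrix.trace_smul, Matrix.trace_one, smul_eq_mul, norm_mul,
    norm_star, hz] at h1
  have hd : (0 : ℝ) < 2 ^ n := by positivity
  have h2 : davg U V ^ 2 = 0 := by
    rw [h1]
    simp
    field_simp
    ring
  exact pow_eq_zero_iff two_ne_zero |>.1 h2

/-- Basis vectors of `ℂ^(2^n)` none of which is orthogonal to the one with index `0`. -/
def anchorKet (j : Qubits n) : Vec (Qubits n) :=
  if j = 0 then EuclideanSpace.single 0 1
  else EuclideanSpace.single 0 1 + EuclideanSpace.single j 1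

lemma inner_anchorKet_zero (j : Qubits n) :
    inner ℂ (anchorKet (0 : Qubits n)) (anchorKet j) = (1 : ℂ) := by
  by_cases h : j = 0
  · simp [anchorKet, h]
  · simp [anchorKet, h, EuclideanSpace.inner_single_left, Ne.symm h]

lemma anchorKet_ne_zero (j : Qubits n) : anchorKet j ≠ 0 := by
  intro h
  have := inner_anchorKet_zero j
  rw [h, inner_zero_right] at this
  exact zero_ne_one this

lemma norm_anchorKet_zero : ‖anchorKet (0 : Qubits n)‖ = 1 := by simp [anchorKet]

/-- A unitary is determined up to a phase by its action, up to phases, on the anchor kets. -/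
lemma eq_smul_of_anchorKet {U U' : Unitaries n} {z : Qubits n → ℂ}
    (h : ∀ j, Matrix.toEuclideanLin (U' : Matrix (Qubits n) (Qubits n) ℂ) (anchorKet j) =
      z j • Matrix.toEuclideanLin (U : Matrix (Qubits n) (Qubits n) ℂ) (anchorKet j)) :
    ‖z 0‖ = 1 ∧ (U' : Matrix (Qubits n) (Qubits n) ℂ) =
      z 0 • (U : Matrix (Qubits n) (Qubits n) ℂ) := by
  have hz0 : ‖z 0‖ = 1 := by
    have h1 := congrArg norm (h 0)
    rw [norm_smul, norm_toEuclideanLin_unitary, norm_toEuclideanLin_unitary, norm_anchorKet_zero,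
      mul_one] at h1
    exact h1.symm
  -- Preservation of the inner product with the anchor e_0 reads conj(z 0) · z j = 1.
  have hz : ∀ j, z j = z 0 := by
    intro j
    have h1 := inner_toEuclideanLin_unitary U' (anchorKet 0) (anchorKet j)
    rw [h, h, inner_smul_left, inner_smul_right, inner_toEuclideanLin_unitary,
      inner_anchorKet_zero, mul_one] at h1
    have h2 : z 0 * (starRingEnd ℂ) (z 0) = 1 := by rw [RCLike.mul_conj, hz0]; simp
    calc z j = (z 0 * (starRingEnd ℂ) (z 0)) * z j := by rw [h2, one_mul]
      _ = z 0 * ((starRingEnd ℂ) (z 0) * z j) := by ring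
      _ = z 0 := by rw [h1, mul_one]
  have hsingle : ∀ j : Qubits n,
      Matrix.toEuclideanLin (U' : Matrix (Qubits n) (Qubits n) ℂ) (EuclideanSpace.single j 1) =
      z 0 • Matrix.toEuclideanLin (U : Matrix (Qubits n) (Qubits n) ℂ)
        (EuclideanSpace.single j 1) := by
    intro j
    have h0 := h 0
    by_cases hj : j = 0
    · subst hj; simpa [anchorKet] using h0
    · have h1 := h j
      rw [hz j] at h1
      simp only [anchorKet, if_true, if_neg hj, map_add, smul_add] at h0 h1
      rw [h0] at h1
      exact add_left_cancel h1
  refine ⟨hz0, ?_⟩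
  ext a j
  have h1 := congrFun (congrArg WithLp.ofLp (hsingle j)) a
  simpa [Matrix.toLpLin_apply] using h1

/-- The index of the anchor ket at position `k` of the block `i`. -/
def blockIndex (n r i k : ℕ) : Qubits n :=
  -- If r does not divide 2^n, the last block is padded with copies of index 0. This is why
  -- multiplicities appear below.
  if h : i * r + k < 2 ^ n then ⟨i * r + k, h⟩ else 0

/-- How often the index `j` occurs in the block `i`. -/
def multiplicity (n r i : ℕ) (j : Qubits n) : ℕ :=
  (Finset.univ.filter fun k : Fin r => blockIndex n r i k = j).card

lemma exists_block (hr : 1 ≤ r) (j : Qubits n) :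
    ∃ i : Fin ⌈(2 : ℝ) ^ n / r⌉₊, multiplicity n r i j ≠ 0 := by
  have hr0 : (0 : ℝ) < r := by exact_mod_cast hr
  refine ⟨⟨j / r, Nat.lt_ceil.2 ?_⟩, ?_⟩
  · refine lt_of_le_of_lt Nat.cast_div_le (div_lt_div_of_pos_right ?_ hr0)
    exact_mod_cast j.2
  · refine Finset.card_ne_zero_of_mem (a := ⟨j % r, Nat.mod_lt _ hr⟩) ?_
    have h : (j : ℕ) / r * r + j % r = j := Nat.div_add_mod' _ _
    rw [Finset.mem_filter]
    refine ⟨Finset.mem_univ _, ?_⟩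
    simp only [blockIndex, h]
    simp

lemma sum_blockIndex (i : ℕ) (j : Qubits n) (f : Qubits n → ℂ) :
    ∑ k : Fin r, (if blockIndex n r i k = j then f (blockIndex n r i k) else 0) =
      multiplicity n r i j * f j := by
  rw [multiplicity, ← nsmul_eq_mul, ← Finset.sum_const, Finset.sum_filter]
  refine Finset.sum_congr rfl fun k _ => ?_
  split_ifs with h
  · rw [h]
  · rfl

/-- The anchor kets of the block `i` entangled with orthogonal flags, not normalized. -/
def blockKet (n r i : ℕ) : Vec (TwoQubits n) :=
  WithLp.toLp 2 fun q => ∑ k : Fin r,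
    if blockIndex n r i k = q.2 then anchorKet (blockIndex n r i k) q.1 else 0

lemma blockKet_apply (i : ℕ) (a j : Qubits n) :
    blockKet n r i (a, j) = multiplicity n r i j * anchorKet j a :=
  sum_blockIndex i j fun j => anchorKet j a

lemma blockKet_ne_zero (hr : 1 ≤ r) (i : ℕ) : blockKet n r i ≠ 0 := by
  intro h
  have hm : multiplicity n r i (blockIndex n r i 0) ≠ 0 :=
    Finset.card_ne_zero_of_mem (a := ⟨0, hr⟩) (by simp)
  refine anchorKet_ne_zero (blockIndex n r i 0) ?_
  ext a
  have h1 := blockKet_apply (r := r) i a (blockIndex n r i 0)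
  rw [h] at h1
  simpa [hm] using h1.symm

lemma isEntangledInput_blockKet (hr : 1 ≤ r) (i : ℕ) :
    IsEntangledInput r (((‖blockKet n r i‖⁻¹ : ℝ) : ℂ) • blockKet n r i) := by
  have hn : ‖blockKet n r i‖ ≠ 0 := norm_ne_zero_iff.2 (blockKet_ne_zero hr i)
  constructor
  · rw [norm_smul, Complex.norm_real, norm_inv, norm_norm, inv_mul_cancel₀ hn]
  · let B : Matrix (Qubits n) (Fin r) ℂ := Matrix.of fun a k =>
      ((‖blockKet n r i‖⁻¹ : ℝ) : ℂ) * anchorKet (blockIndex n r i k) a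
    let C : Matrix (Fin r) (Qubits n) ℂ := Matrix.of fun k j =>
      if blockIndex n r i k = j then 1 else 0
    have h : (Matrix.of fun a j : Qubits n =>
        (((‖blockKet n r i‖⁻¹ : ℝ) : ℂ) • blockKet n r i) (a, j)) = B * C := by
      ext a j
      simp [B, C, Matrix.mul_apply, blockKet, Finset.mul_sum]
    rw [schmidtRank, h]
    refine (Matrix.rank_mul_le_left B C).trans ?_
    simpa using Matrix.rank_le_card_width B

/-- Since the flag is untouched by U ⊗ I, the component with flag j is a nonzero multiple of the
image of the anchor j. -/
lemma toEuclideanLin_anchorKet_of_blockKet (hr : 1 ≤ r) {U U' : Unitaries n} {i : ℕ} {z : ℂ}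
    (h : applyKet U' (((‖blockKet n r i‖⁻¹ : ℝ) : ℂ) • blockKet n r i) =
      z • applyKet U (((‖blockKet n r i‖⁻¹ : ℝ) : ℂ) • blockKet n r i)) {j : Qubits n}
    (hj : multiplicity n r i j ≠ 0) :
    Matrix.toEuclideanLin (U' : Matrix (Qubits n) (Qubits n) ℂ) (anchorKet j) =
      z • Matrix.toEuclideanLin (U : Matrix (Qubits n) (Qubits n) ℂ) (anchorKet j) := by
  have hn : ((‖blockKet n r i‖⁻¹ : ℝ) : ℂ) ≠ 0 := by
    simpa using blockKet_ne_zero hr i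
  have hm : (multiplicity n r i j : ℂ) ≠ 0 := by exact_mod_cast hj
  have happ : ∀ (V : Unitaries n) (a : Qubits n),
      applyKet V (((‖blockKet n r i‖⁻¹ : ℝ) : ℂ) • blockKet n r i) (a, j) =
      ((‖blockKet n r i‖⁻¹ : ℝ) : ℂ) * multiplicity n r i j *
        Matrix.toEuclideanLin (V : Matrix (Qubits n) (Qubits n) ℂ) (anchorKet j) a := by
    intro V a
    rw [applyKet_apply, Matrix.toLpLin_apply]
    simp only [Matrix.mulVec, dotProduct, Finset.mul_sum]
    refine Finset.sum_congr rfl fun c _ => ?_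
    rw [PiLp.smul_apply, blockKet_apply, smul_eq_mul]
    ring
  ext a
  have h1 := congrFun (congrArg WithLp.ofLp h) (a, j)
  rw [PiLp.smul_apply, happ, happ, smul_eq_mul, mul_left_comm] at h1
  exact mul_left_cancel₀ (mul_ne_zero hn hm) h1

lemma entangled_upper_bound (n r : ℕ) (hr : 1 ≤ r) :
    ∃ x : Fin ⌈(2 : ℝ) ^ n / r⌉₊ → Vec (TwoQubits n),
      (∀ i, IsEntangledInput r (x i)) ∧
      ∃ H : (Fin ⌈(2 : ℝ) ^ n / r⌉₊ → Vec (TwoQubits n)) → Unitaries n,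
        (∀ U : Unitaries n, H (fun i => applyKet U (x i)) = U) ∧
        (∀ (U : Unitaries n) (z : Fin ⌈(2 : ℝ) ^ n / r⌉₊ → ℂ), (∀ i, ‖z i‖ = 1) →
          EqUpToPhase (H (fun i => z i • applyKet U (x i))) U ∧
          davg (H (fun i => z i • applyKet U (x i))) U = 0) := by
  classical
  let x : Fin ⌈(2 : ℝ) ^ n / r⌉₊ → Vec (TwoQubits n) := fun i =>
    ((‖blockKet n r i‖⁻¹ : ℝ) : ℂ) • blockKet n r i
  choose blk hblk using exists_block (n := n) hr
  have key : ∀ (U U' : Unitaries n) (z : Fin ⌈(2 : ℝ) ^ n / r⌉₊ → ℂ),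
      (∀ i, applyKet U' (x i) = z i • applyKet U (x i)) →
      ‖z (blk 0)‖ = 1 ∧ (U' : Matrix (Qubits n) (Qubits n) ℂ) =
        z (blk 0) • (U : Matrix (Qubits n) (Qubits n) ℂ) := fun U U' z h =>
    eq_smul_of_anchorKet (z := fun j => z (blk j)) fun j =>
      toEuclideanLin_anchorKet_of_blockKet hr (h (blk j)) (hblk j)
  have keyExact : ∀ U U' : Unitaries n, (∀ i, applyKet U' (x i) = applyKet U (x i)) → U' = U := by
    intro U U' h
    have h1 := (key U U' (fun _ => 1) (by simpa using h)).2
    exact Subtype.ext (by simpa using h1)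
  -- Exact consistency is tested first, so that phase-free data return U itself. Rephased data may
  -- also pass this test for another unitary, which then differs from U by a phase only.
  let H : (Fin ⌈(2 : ℝ) ^ n / r⌉₊ → Vec (TwoQubits n)) → Unitaries n := fun y =>
    if h : ∃ U : Unitaries n, ∀ i, y i = applyKet U (x i) then h.choose
    else if h : ∃ (U : Unitaries n) (z : Fin ⌈(2 : ℝ) ^ n / r⌉₊ → ℂ),
        (∀ i, ‖z i‖ = 1) ∧ ∀ i, y i = z i • applyKet U (x i) then h.choose
    else 1
  refine ⟨x, fun i => isEntangledInput_blockKet hr i, H, fun U => ?_, fun U z hz => ?_⟩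
  · have h : ∃ V : Unitaries n, ∀ i, applyKet U (x i) = applyKet V (x i) := ⟨U, fun _ => rfl⟩
    have hH : H (fun i => applyKet U (x i)) = h.choose := dif_pos h
    rw [hH]
    exact keyExact _ _ fun i => (h.choose_spec i).symm
  · have hEq : EqUpToPhase (H (fun i => z i • applyKet U (x i))) U := by
      by_cases h : ∃ V : Unitaries n, ∀ i, z i • applyKet U (x i) = applyKet V (x i)
      · have hH : H (fun i => z i • applyKet U (x i)) = h.choose := dif_pos h
        rw [hH]
        exact ⟨_, key U _ z fun i => (h.choose_spec i).symm⟩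
      · have h' : ∃ (V : Unitaries n) (w : Fin ⌈(2 : ℝ) ^ n / r⌉₊ → ℂ),
            (∀ i, ‖w i‖ = 1) ∧ ∀ i, z i • applyKet U (x i) = w i • applyKet V (x i) :=
          ⟨U, z, hz, fun _ => rfl⟩
        have hH : H (fun i => z i • applyKet U (x i)) = h'.choose :=
          (dif_neg h).trans (dif_pos h')
        rw [hH]
        obtain ⟨w, hw, hspec⟩ := h'.choose_spec
        refine ⟨_, key U _ (fun i => (w i)⁻¹ * z i) fun i => ?_⟩
        have hw0 : w i ≠ 0 := norm_ne_zero_iff.1 (by rw [hw i]; exact one_ne_zero)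
        rw [mul_smul, hspec i, smul_smul, inv_mul_cancel₀ hw0, one_smul]
    exact ⟨hEq, davg_eq_zero_of_eqUpToPhase hEq⟩

/-- Apply both projectors to a. -/
lemma eq_smul_of_ketbra_eq {ι : Type} [Fintype ι] {a b : Vec ι} (ha : ‖a‖ = 1)
    (h : ketbra a = ketbra b) : a = (inner ℂ b a : ℂ) • b := by
  have h1 : (ketbra a).mulVec a.ofLp = a.ofLp := by
    rw [ketbra, Matrix.vecMulVec_mulVec, star_dotProduct_self_of_norm_one ha]; simp
  rw [h, ketbra, Matrix.vecMulVec_mulVec, ← inner_eq_star_dotProduct] at h1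
  ext i
  rw [← congrFun h1 i]
  simp [mul_comm]

/-- The normalized anchor kets. -/
def unitAnchorKet (j : Qubits n) : Vec (Qubits n) :=
  ((‖anchorKet j‖⁻¹ : ℝ) : ℂ) • anchorKet j

lemma norm_unitAnchorKet (j : Qubits n) : ‖unitAnchorKet j‖ = 1 := by
  rw [unitAnchorKet, norm_smul, Complex.norm_real, norm_inv, norm_norm,
    inv_mul_cancel₀ (norm_ne_zero_iff.2 (anchorKet_ne_zero j))]

/-- The uniform mixture of the anchor kets of the block `i`, flagged by orthogonal states. -/
def blockDensity (n r i : ℕ) : Matrix (TwoQubits n) (TwoQubits n) ℂ :=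
  ∑ k : Fin r, (((1 / r : ℝ)) : ℂ) • (ketbra (unitAnchorKet (blockIndex n r i k)) ⊗ₖ
    ketbra (EuclideanSpace.single (blockIndex n r i k) 1))

lemma isMixedInput_blockDensity (hr : 1 ≤ r) (i : ℕ) : IsMixedInput r (blockDensity n r i) := by
  have hr0 : (r : ℝ) ≠ 0 := by positivity
  refine ⟨fun _ => 1 / r, fun k => unitAnchorKet (blockIndex n r i k),
    fun k => EuclideanSpace.single (blockIndex n r i k) 1, fun _ => by positivity, ?_,
    fun k => norm_unitAnchorKet _, fun k => by simp, rfl⟩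
  simp [hr0]

/-- The diagonal block with flag j is a nonzero multiple of the projector onto the image of the
anchor j. The phase may depend on j even within one block; the anchors remove this freedom. -/
lemma exists_phase_of_blockDensity (hr : 1 ≤ r) {U U' : Unitaries n} {i : ℕ}
    (h : applyDensity U' (blockDensity n r i) = applyDensity U (blockDensity n r i)) {j : Qubits n}
    (hj : multiplicity n r i j ≠ 0) :
    ∃ z : ℂ, Matrix.toEuclideanLin (U' : Matrix (Qubits n) (Qubits n) ℂ) (anchorKet j) =
      z • Matrix.toEuclideanLin (U : Matrix (Qubits n) (Qubits n) ℂ) (anchorKet j) := by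
  have hr0 : ((1 / r : ℝ) : ℂ) ≠ 0 := by
    have : (1 / r : ℝ) ≠ 0 := by positivity
    exact_mod_cast this
  have hm : (multiplicity n r i j : ℂ) ≠ 0 := by exact_mod_cast hj
  have happ : ∀ (V : Unitaries n) (a b : Qubits n),
      applyDensity V (blockDensity n r i) (a, j) (b, j) =
      ((1 / r : ℝ) : ℂ) * multiplicity n r i j *
        ketbra (Matrix.toEuclideanLin (V : Matrix (Qubits n) (Qubits n) ℂ)
          (unitAnchorKet j)) a b := by
    intro V a b
    rw [blockDensity, applyDensity_sum V (fun _ => 1 / r), mul_assoc, ← sum_blockIndex i j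
      (fun j => ketbra (Matrix.toEuclideanLin (V : Matrix (Qubits n) (Qubits n) ℂ)
          (unitAnchorKet j)) a b), Finset.mul_sum, Matrix.sum_apply]
    refine Finset.sum_congr rfl fun k _ => ?_
    rw [Matrix.smul_apply, smul_eq_mul]
    congr 1
    rw [← ketbra_kronecker_ketbra, Matrix.kronecker_apply]
    by_cases hk : blockIndex n r i k = j
    · simp [hk, ketbra, Matrix.vecMulVec_apply]
    · simp [hk, Ne.symm hk, ketbra, Matrix.vecMulVec_apply]
  have hket : ketbra (Matrix.toEuclideanLin (U' : Matrix (Qubits n) (Qubits n) ℂ)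
      (unitAnchorKet j)) = ketbra (Matrix.toEuclideanLin (U : Matrix (Qubits n) (Qubits n) ℂ)
      (unitAnchorKet j)) := by
    ext a b
    have h1 := congrFun (congrFun h (a, j)) (b, j)
    rw [happ, happ] at h1
    exact mul_left_cancel₀ (mul_ne_zero hr0 hm) h1
  have h2 := eq_smul_of_ketbra_eq
    ((norm_toEuclideanLin_unitary U' _).trans (norm_unitAnchorKet j)) hket
  have hn : ((‖anchorKet j‖⁻¹ : ℝ) : ℂ) ≠ 0 := by simpa using anchorKet_ne_zero j
  generalize inner ℂ (Matrix.toEuclideanLin (U : Matrix (Qubits n) (Qubits n) ℂ)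
    (unitAnchorKet j)) _ = w at h2
  refine ⟨w, smul_right_injective _ hn ?_⟩
  simp only
  rw [smul_comm, ← map_smul, ← map_smul]
  exact h2

lemma mixed_upper_bound (n r : ℕ) (hr : 1 ≤ r) :
    ∃ ρ : Fin ⌈(2 : ℝ) ^ n / r⌉₊ → Matrix (TwoQubits n) (TwoQubits n) ℂ,
      (∀ i, IsMixedInput r (ρ i)) ∧
      ∃ H : (Fin ⌈(2 : ℝ) ^ n / r⌉₊ → Matrix (TwoQubits n) (TwoQubits n) ℂ) → Unitaries n,
        ∀ U : Unitaries n,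
          EqUpToPhase (H (fun i => applyDensity U (ρ i))) U ∧
          davg (H (fun i => applyDensity U (ρ i))) U = 0 := by
  classical
  let ρ : Fin ⌈(2 : ℝ) ^ n / r⌉₊ → Matrix (TwoQubits n) (TwoQubits n) ℂ := fun i =>
    blockDensity n r i
  let H : (Fin ⌈(2 : ℝ) ^ n / r⌉₊ → Matrix (TwoQubits n) (TwoQubits n) ℂ) → Unitaries n :=
    fun y => if h : ∃ U : Unitaries n, ∀ i, y i = applyDensity U (ρ i) then h.choose else 1
  refine ⟨ρ, fun i => isMixedInput_blockDensity hr i, H, fun U => ?_⟩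
  have h : ∃ V : Unitaries n, ∀ i, applyDensity U (ρ i) = applyDensity V (ρ i) :=
    ⟨U, fun _ => rfl⟩
  have hH : H (fun i => applyDensity U (ρ i)) = h.choose := dif_pos h
  have hEq : EqUpToPhase (H (fun i => applyDensity U (ρ i))) U := by
    rw [hH]
    have hphase : ∀ j : Qubits n, ∃ z : ℂ, Matrix.toEuclideanLin
        (h.choose : Matrix (Qubits n) (Qubits n) ℂ) (anchorKet j) =
        z • Matrix.toEuclideanLin (U : Matrix (Qubits n) (Qubits n) ℂ) (anchorKet j) := by
      intro j
      obtain ⟨i, hi⟩ := exists_block hr j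
      exact exists_phase_of_blockDensity hr (h.choose_spec i).symm hi
    choose z hz using hphase
    exact ⟨_, eq_smul_of_anchorKet hz⟩
  exact ⟨hEq, davg_eq_zero_of_eqUpToPhase hEq⟩

end UpperBound

end UnitaryLearning

end

open UnitaryLearning in
theorem theorem5 :
    -- upper bound, entangled inputs
    (∀ n r : ℕ, 1 ≤ r →
      ∃ x : Fin ⌈(2 : ℝ) ^ n / r⌉₊ → Vec (TwoQubits n),
        (∀ i, IsEntangledInput r (x i)) ∧
        ∃ H : (Fin ⌈(2 : ℝ) ^ n / r⌉₊ → Vec (TwoQubits n)) → Unitaries n,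
          -- from the output vectors, `U` itself is recovered
          (∀ U : Unitaries n, H (fun i => applyKet U (x i)) = U) ∧
          -- if every output vector is only described up to a phase of its own,
          -- `U` is recovered up to a global phase
          (∀ (U : Unitaries n) (z : Fin ⌈(2 : ℝ) ^ n / r⌉₊ → ℂ), (∀ i, ‖z i‖ = 1) →
            EqUpToPhase (H (fun i => z i • applyKet U (x i))) U ∧
            davg (H (fun i => z i • applyKet U (x i))) U = 0)) ∧
    -- upper bound, classically mixed inputs
    (∀ n r : ℕ, 1 ≤ r →
      ∃ ρ : Fin ⌈(2 : ℝ) ^ n / r⌉₊ → Matrix (TwoQubits n) (TwoQubits n) ℂ,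
        (∀ i, IsMixedInput r (ρ i)) ∧
        ∃ H : (Fin ⌈(2 : ℝ) ^ n / r⌉₊ → Matrix (TwoQubits n) (TwoQubits n) ℂ) → Unitaries n,
          ∀ U : Unitaries n,
            EqUpToPhase (H (fun i => applyDensity U (ρ i))) U ∧
            davg (H (fun i => applyDensity U (ρ i))) U = 0) ∧
    -- lower bounds for noise-robust learners
    (∀ ε₀ : ℝ, ε₀ < 1 → ∃ n₀ : ℕ, (ε₀ ≤ 1 / 3 → n₀ ≤ 1) ∧
      ∀ κ : ℝ, 0 < κ → ∃ c : ℝ, 0 < c ∧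
      ∀ n r N : ℕ, n₀ ≤ n → 1 ≤ r → ∀ ε η : ℝ, 0 < ε → ε ≤ ε₀ → κ * ε ≤ η →
        ∀ (Ω : Type) [MeasurableSpace Ω] (P : MeasureTheory.Measure Ω)
          [MeasureTheory.IsProbabilityMeasure P],
          (∀ L : Learner n (EntangledInput n r) (Ket n) Ω,
            L.Learns P N ε (EntangledNoisy η) → c * (2 ^ n / r) ≤ N) ∧
          (∀ L : Learner n (MixedInput n r) (Density n) Ω,
            L.Learns P N ε (MixedNoisy η) → c * (2 ^ n / r) ≤ N)) := by
  refine ⟨entangled_upper_bound, mixed_upper_bound, fun ε₀ hε₀ => ?_⟩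
  obtain ⟨n₀, hn₀, h⟩ := queries_lower_bound hε₀
  refine ⟨n₀, hn₀, fun κ hκ => ?_⟩
  obtain ⟨c, hc, h⟩ := h κ hκ
  refine ⟨c, hc, fun n r N hn hr ε η hε hεε₀ hη Ω _ P _ => ⟨fun L hL => ?_, fun L hL => ?_⟩⟩
  · exact h n r N hn hr ε η hε hεε₀ hη Ω P _ _ _ quantizable_entangledNoisy L hL
  · exact h n r N hn hr ε η hε hεε₀ hη Ω P _ _ _ quantizable_mixedNoisy L hL
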